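/- Let $\mathbb T^2=\mathbb R^2/\mathbb Z^2$ and $\mathbb A=\mathbb R/\mathbb Z\times\mathbb R$, let $\pi$ denote either of the canonical projections $\mathbb R^2\to\mathbb T^2$ and $\mathbb R^2\to\mathbb A$, and let $T(x,y)=(x+1,y)$ on $\mathbb R^2$. A continuum is a non-empty compact connected set. $\mathrm{Homeo}_0(X)$ is the set of homeomorphisms of $X$ that are homotopic to the identity. A set is thin if it has empty interior. An essential annular continuum $A\subseteq\mathbb T^2$ is a continuum whose complement is homeomorphic to $\mathbb A$. It is horizontal if its complement contains a simple closed curve of homotopy type $(1,0)$, i.e. one with a lift $\gamma:\mathbb R\to\mathbb R^2$ such that $\gamma(t+1)=\gamma(t)+(1,0)$. A horizontal $A$ has a compact generator if some connected component of $\pi^{-1}(A)$ contains a non-empty compact connected set $G_0$ with $\pi\big(\bigcup_{n\in\mathbb Z}T^n(G_0)\big)=A$. An essential annular continuum in $\mathbb T^2$ is compactly generated if some homeomorphism of $\mathbb T^2$ maps it to a horizontal one with a compact generator. An essential annular continuum $A\subseteq\mathbb A$ is a continuum whose complement is the union of two distinct unbounded connected components. It is compactly generated if there is a non-empty compact connected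 set $G_0\subseteq\mathbb R^2$ with $\bigcup_{n\in\mathbb Z}T^n(G_0)=\pi^{-1}(A)$. **Theorem.** (a) Let $f\in\mathrm{Homeo}_0(\mathbb T^2)$, let $F:\mathbb R^2\to\mathbb R^2$ be a lift of $f$ (a continuous map with $\pi\circ F=f\circ\pi$), and let $A\subseteq\mathbb T^2$ be a thin, compactly generated essential annular continuum with $f(A)=A$. Then $f_{|A}$ has a unique rotation vector: there is $\rho\in\mathbb R^2$ such that $$\lim_{n\to\infty}\frac{F^n(z)-z}{n}=\rho\qquad\text{for all } z\in\mathbb R^2 \text{ with } \pi(z)\in A,$$ and the convergence is uniform in $z\in\pi^{-1}(A)$. (b) Let $f\in\mathrm{Homeo}_0(\mathbb A)$, let $F:\mathbb R^2\to\mathbb R^2$ be a lift of $f$, and let $A\subseteq\mathbb A$ be a thin, compactly generated essential annular continuum with $f(A)=A$. Then there is $\rho\in\mathbb R$ such that $\lim_{n\to\infty}(F^n(z)-z)/n=(\rho,0)$ for all $z\in\pi^{-1}(A)$, and the convergence is uniform in $z\in\pi^{-1}(A)$. -/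

import Mathlib

open Filter Topology

/-- The two-dimensional torus `𝕋² = ℝ²/ℤ²`. -/
abbrev Torus2 : Type := UnitAddCircle × UnitAddCircle

/-- The open annulus `𝔸 = 𝕋¹ × ℝ`. -/
abbrev OpenAnnulus : Type := UnitAddCircle × ℝ

/-- The canonical projection `ℝ² → 𝕋²`. -/
def torusProj (z : ℝ × ℝ) : Torus2 := ((z.1 : UnitAddCircle), (z.2 : UnitAddCircle))

/-- The canonical projection `ℝ² → 𝔸`. -/
def annulusProj (z : ℝ × ℝ) : OpenAnnulus := ((z.1 : UnitAddCircle), z.2)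

/-- The `n`-th iterate `Tⁿ` of the translation `T (x, y) = (x + 1, y)`, for `n : ℤ`. -/
def horizontalShift (n : ℤ) (z : ℝ × ℝ) : ℝ × ℝ := (z.1 + n, z.2)

/-- Membership in `Homeo₀ X`: the homeomorphism `f` is homotopic to the identity. -/
def IsHomotopicToId {X : Type} [TopologicalSpace X] (f : X ≃ₜ X) : Prop :=
  ContinuousMap.Homotopic (f : C(X, X)) (ContinuousMap.id X)

/-- `F` is a (continuous) lift of `f` to the plane with respect to the projection `proj`. -/
def IsPlaneLift {X : Type} (proj : ℝ × ℝ → X) (f : X → X) (F : ℝ × ℝ → ℝ × ℝ) : Prop :=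
  Continuous F ∧ ∀ z, proj (F z) = f (proj z)

/-- A set is thin if it has empty interior. -/
def IsThin {X : Type} [TopologicalSpace X] (A : Set X) : Prop := interior A = ∅

/-- An essential annular continuum in the torus: a continuum whose complement is homeomorphic to
the open annulus. -/
def IsEssentialAnnularContinuumTorus (A : Set Torus2) : Prop :=
  IsCompact A ∧ IsConnected A ∧ Nonempty ((Aᶜ : Set Torus2) ≃ₜ OpenAnnulus)

/-- The homotopy type of `A` is `(1, 0)`: the complement of `A` contains a simple closed curve of
homotopy type `(1, 0)`. The curve is given by its lift `γ` to the plane. -/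
def IsHorizontalTorus (A : Set Torus2) : Prop :=
  ∃ γ : ℝ → ℝ × ℝ, Continuous γ ∧ (∀ t, γ (t + 1) = γ t + (1, 0)) ∧
    (∀ s t, torusProj (γ s) = torusProj (γ t) → ∃ n : ℤ, t = s + n) ∧
    ∀ t, torusProj (γ t) ∉ A

/-- The generator condition for a horizontal essential annular continuum in the torus: some
component of the preimage of `A` in the plane contains a compact connected set `G` such that the
translates `Tⁿ G` together project onto `A`. -/
def HasCompactGeneratorTorus (A : Set Torus2) : Prop :=
  ∃ x ∈ torusProj ⁻¹' A, ∃ G : Set (ℝ × ℝ), IsCompact G ∧ IsConnected G ∧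
    G ⊆ connectedComponentIn (torusProj ⁻¹' A) x ∧
    torusProj '' (⋃ n : ℤ, horizontalShift n '' G) = A

/-- An essential annular continuum in the torus of arbitrary homotopy type is compactly generated
if some homeomorphism of the torus maps it to a horizontal one with a compact generator. -/
def IsCompactlyGeneratedTorus (A : Set Torus2) : Prop :=
  ∃ h : Torus2 ≃ₜ Torus2, IsEssentialAnnularContinuumTorus (h '' A) ∧
    IsHorizontalTorus (h '' A) ∧ HasCompactGeneratorTorus (h '' A)

/-- An essential annular continuum in the open annulus: a continuum whose complement is the union
of two distinct unbounded connected components. -/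
def IsEssentialAnnularContinuumAnnulus (A : Set OpenAnnulus) : Prop :=
  IsCompact A ∧ IsConnected A ∧ ∃ x ∈ Aᶜ, ∃ y ∈ Aᶜ,
    connectedComponentIn Aᶜ x ≠ connectedComponentIn Aᶜ y ∧
    ¬ Bornology.IsBounded (connectedComponentIn Aᶜ x) ∧
    ¬ Bornology.IsBounded (connectedComponentIn Aᶜ y) ∧
    Aᶜ = connectedComponentIn Aᶜ x ∪ connectedComponentIn Aᶜ y

/-- An essential annular continuum in the open annulus is compactly generated if its preimage in
the plane is the union of the translates `Tⁿ G` of a compact connected set `G`. -/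
def IsCompactlyGeneratedAnnulus (A : Set OpenAnnulus) : Prop :=
  ∃ G : Set (ℝ × ℝ), IsCompact G ∧ IsConnected G ∧
    ⋃ n : ℤ, horizontalShift n '' G = annulusProj ⁻¹' A

/-- The mean displacement `(Fⁿ(z) - z) / n`. -/
noncomputable def meanDisplacement (F : ℝ × ℝ → ℝ × ℝ) (n : ℕ) (z : ℝ × ℝ) : ℝ × ℝ :=
  (n : ℝ)⁻¹ • (F^[n] z - z)

/-!
Write `S ⊆ ℝ²` for the preimage of the invariant continuum and `Λ` for the deck group. In both parts
`S` is the union of the translates `G + m`, `m ∈ Λ`, of a plane continuum `G`; `S` has empty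
interior; every component of its complement is unbounded; and the lift `F` is injective, maps `S`
to itself and commutes with `Λ`.

Such a system has uniformly bounded diameters of the sets `Fⁿ(G)`. If `G` is disjoint from its
nontrivial translates, then the connected set `Fⁿ(G)` lies in one translate of `G`
(`IsGeneratedInvariant.bounded_of_disjoint`). Otherwise `G` meets `G + v` for some `v ≠ 0`. Fix `N`
such that `G` is disjoint from `G + N v`; then `H = Fⁿ(G)` is disjoint from `H + N v`. A finite
chain of translates of `G` is a continuum `P` containing `G` and `G + N v`, so that any point of `H`
lies in a translate of `P` that meets both `H` and `H + N v`. If `H` is wide, there are two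
disjoint such translates `P₁` and `P₂`, and the continua `H ∪ P₁` and `(H + N v) ∪ P₂` have a
disconnected intersection. By a theorem of Janiszewski
(`isPreconnected_inter_of_unbounded_compl`) the complement of their union has a bounded component;
since `S` is thin, this component contains a point off `S`, and hence a whole component of the
complement of `S`, a contradiction (`IsGeneratedInvariant.bounded_of_meets`). Bounded diameters make
`n ↦ Fⁿ(z) - z` additive up to a bounded error, uniformly on `S`, and such a sequence is at bounded
distance from a linear one (`exists_norm_inv_smul_sub_le_of_quasiadditive`).

Janiszewski's theorem follows from Borsuk's criterion (`IsTame.hasLogOn`): on a plane compactum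
whose complement has no bounded component, every non-vanishing continuous function has a continuous
logarithm. For the functions `z - q` this is seen by moving `q` to infinity in the complement. In
general, cut the compactum into small squares, on which a logarithm exists, and reassemble it along
lines: the logarithms on the two sides of a line differ on it by a locally constant function, whose
jumps, at points `q` of the line off the compactum, are removed by comparing the global logarithm of
`z - q` with the principal branches on the two sides.

That the components of the complement of `S` are unbounded follows from the fact that a component of
the preimage of an open set projects onto full components
(`IsPlaneCover.subset_image_connectedComponentIn`): in the annulus these are unbounded by
hypothesis, and in the torus each component contains a lift of an essential closed curve.
-/

/-! ### Continuous logarithms on tame sets -/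

/-- `f` has a continuous logarithm on `Y`. -/
def HasLogOn (f : ℂ → ℂ) (Y : Set ℂ) : Prop :=
  ∃ h : ℂ → ℂ, ContinuousOn h Y ∧ ∀ z ∈ Y, Complex.exp (h z) = f z

/-- A compact plane set such that for each point `q` off it, `z ↦ z - q` has a continuous
logarithm on the set. -/
def IsTame (Y : Set ℂ) : Prop :=
  IsCompact Y ∧ ∀ q ∉ Y, HasLogOn (fun z => z - q) Y

theorem HasLogOn.mono {f : ℂ → ℂ} {Y Z : Set ℂ} (h : HasLogOn f Y) (hZ : Z ⊆ Y) :
    HasLogOn f Z := by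
  obtain ⟨l, hl, he⟩ := h
  exact ⟨l, hl.mono hZ, fun z hz => he z (hZ hz)⟩

theorem HasLogOn.mul {f g : ℂ → ℂ} {Y : Set ℂ} (hf : HasLogOn f Y) (hg : HasLogOn g Y) :
    HasLogOn (fun z => f z * g z) Y := by
  obtain ⟨l, hl, he⟩ := hf
  obtain ⟨m, hm, hme⟩ := hg
  exact ⟨fun z => l z + m z, hl.add hm, fun z hz => by rw [Complex.exp_add, he z hz, hme z hz]⟩

theorem HasLogOn.congr {f g : ℂ → ℂ} {Y : Set ℂ} (hf : HasLogOn f Y) (h : Set.EqOn f g Y) :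
    HasLogOn g Y := by
  obtain ⟨l, hl, he⟩ := hf
  exact ⟨l, hl, fun z hz => (he z hz).trans (h hz)⟩

theorem hasLogOn_const {c : ℂ} (hc : c ≠ 0) (Y : Set ℂ) : HasLogOn (fun _ => c) Y :=
  ⟨fun _ => Complex.log c, continuousOn_const, fun _ _ => Complex.exp_log hc⟩

theorem hasLogOn_of_mem_slitPlane {f : ℂ → ℂ} {Y : Set ℂ} (hf : ContinuousOn f Y)
    (h : ∀ z ∈ Y, f z ∈ Complex.slitPlane) : HasLogOn f Y :=
  ⟨fun z => Complex.log (f z), hf.clog h, fun z hz =>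
    Complex.exp_log (Complex.slitPlane_ne_zero (h z hz))⟩

theorem mem_slitPlane_of_norm_sub_one_lt {z : ℂ} (h : ‖z - 1‖ < 1) : z ∈ Complex.slitPlane := by
  have := Complex.mem_slitPlane_of_norm_lt_one h
  simpa using this

/-- Two logarithms on closed sets that agree on the overlap glue. -/
theorem hasLogOn_union {f h₁ h₂ : ℂ → ℂ} {Y₁ Y₂ : Set ℂ} (hY₁ : IsClosed Y₁) (hY₂ : IsClosed Y₂)
    (h₁c : ContinuousOn h₁ Y₁) (h₂c : ContinuousOn h₂ Y₂)
    (h₁e : ∀ z ∈ Y₁, Complex.exp (h₁ z) = f z) (h₂e : ∀ z ∈ Y₂, Complex.exp (h₂ z) = f z)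
    (hag : ∀ z ∈ Y₁, z ∈ Y₂ → h₁ z = h₂ z) : HasLogOn f (Y₁ ∪ Y₂) := by
  classical
  refine ⟨fun z => if z ∈ Y₁ then h₁ z else h₂ z, ?_, ?_⟩
  · refine ContinuousOn.union_of_isClosed (h₁c.congr ?_) (h₂c.congr ?_) hY₁ hY₂
    · intro z hz; simp [hz]
    · intro z hz
      by_cases hz1 : z ∈ Y₁
      · simp [hz1, hag z hz1 hz]
      · simp [hz1]
  · intro z hz
    by_cases hz1 : z ∈ Y₁
    · simp [hz1, h₁e z hz1]
    · simp [hz1, h₂e z (hz.resolve_left hz1)]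

theorem IsTame.inter_halfPlane {Y : Set ℂ} (hY : IsTame Y) {ω : ℂ} (hω : ω ≠ 0) (c : ℝ) :
    IsTame (Y ∩ {z | (ω * z).re ≤ c}) := by
  refine ⟨hY.1.inter_right (isClosed_le (by fun_prop) continuous_const), fun q hq => ?_⟩
  by_cases hqY : q ∈ Y
  · have hqc : c < (ω * q).re := by
      by_contra h
      exact hq ⟨hqY, not_lt.mp h⟩
    have h1 : HasLogOn (fun z => ω * (q - z)) (Y ∩ {z | (ω * z).re ≤ c}) := by
      refine hasLogOn_of_mem_slitPlane (by fun_prop) fun z hz => Or.inl ?_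
      have : (ω * z).re ≤ c := hz.2
      rw [mul_sub, Complex.sub_re]
      linarith
    refine (h1.mul (hasLogOn_const (neg_ne_zero.mpr (inv_ne_zero hω)) _)).congr fun z _ => ?_
    field_simp
    ring
  · exact (hY.2 q hqY).mono Set.inter_subset_left

theorem IsTame.inter_halfPlane' {Y : Set ℂ} (hY : IsTame Y) {ω : ℂ} (hω : ω ≠ 0) (c : ℝ) :
    IsTame (Y ∩ {z | c ≤ (ω * z).re}) := by
  have := hY.inter_halfPlane (neg_ne_zero.mpr hω) (-c)
  simpa only [neg_mul, Complex.neg_re, neg_le_neg_iff] using this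

/-- The branches of `log w` on the closed right half-plane and `log (-w) - iπ` on the closed left
half-plane agree on the lower imaginary half-axis. -/
theorem log_neg_sub_log_of_neg {s : ℝ} (hs : s < 0) :
    Complex.log (-(Complex.I * s)) - Real.pi * Complex.I - Complex.log (Complex.I * s) = 0 := by
  have h1 : -(Complex.I * s) = ((-s : ℝ) : ℂ) * Complex.I := by push_cast; ring
  have h2 : Complex.I * s = ((-s : ℝ) : ℂ) * (-Complex.I) := by push_cast; ring
  rw [h1, h2, Complex.log_ofReal_mul (by linarith) Complex.I_ne_zero,
    Complex.log_ofReal_mul (by linarith) (neg_ne_zero.mpr Complex.I_ne_zero), Complex.log_I,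
    Complex.log_neg_I]
  ring

/-- On the upper imaginary half-axis the two branches differ by a full turn. -/
theorem log_neg_sub_log_of_pos {s : ℝ} (hs : 0 < s) :
    Complex.log (-(Complex.I * s)) - Real.pi * Complex.I - Complex.log (Complex.I * s) =
      -(2 * Real.pi * Complex.I) := by
  have h1 : -(Complex.I * s) = (s : ℂ) * (-Complex.I) := by ring
  have h2 : Complex.I * s = (s : ℂ) * Complex.I := by ring
  rw [h1, h2, Complex.log_ofReal_mul hs Complex.I_ne_zero,
    Complex.log_ofReal_mul hs (neg_ne_zero.mpr Complex.I_ne_zero), Complex.log_I,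
    Complex.log_neg_I]
  ring

/-- For a point `q` off a tame set `Y`, there are functions with values in `2πiℤ`, one on each side
of the line `re (ω z) = re (ω q)`, that differ on the line by `-2πi` above `q` and agree below. -/
theorem IsTame.exists_jump {Y : Set ℂ} (hY : IsTame Y) {ω : ℂ} (hω : ω ≠ 0) {c : ℝ} {q : ℂ}
    (hq : q ∉ Y) (hqc : (ω * q).re = c) :
    ∃ g₁ g₂ : ℂ → ℂ, ContinuousOn g₁ (Y ∩ {z | (ω * z).re ≤ c}) ∧
      ContinuousOn g₂ (Y ∩ {z | c ≤ (ω * z).re}) ∧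
      (∀ z ∈ Y, Complex.exp (g₁ z) = 1) ∧ (∀ z ∈ Y, Complex.exp (g₂ z) = 1) ∧
      (∀ z ∈ Y, (ω * z).re = c → (ω * z).im < (ω * q).im → g₁ z = g₂ z) ∧
      (∀ z ∈ Y, (ω * z).re = c → (ω * q).im < (ω * z).im →
        g₂ z - g₁ z = -(2 * Real.pi * Complex.I)) := by
  obtain ⟨l, hl, hle⟩ := hY.2 q hq
  have hne : ∀ z ∈ Y, ω * (z - q) ≠ 0 := fun z hz =>
    mul_ne_zero hω (sub_ne_zero.mpr fun h => hq (h ▸ hz))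
  have key : ∀ z, (ω * z).re = c →
      ω * (z - q) = Complex.I * (((ω * z).im - (ω * q).im : ℝ) : ℂ) := by
    intro z hz
    apply Complex.ext
    · rw [mul_sub, Complex.sub_re, hz, hqc]; simp
    · rw [mul_sub, Complex.sub_im]; simp
  have hslit : ∀ w : ℂ, w ≠ 0 → 0 ≤ w.re → w ∈ Complex.slitPlane := by
    intro w hw h
    rcases h.lt_or_eq with h | h
    · exact Or.inl h
    · right
      intro h'
      exact hw (Complex.ext h.symm h')
  refine ⟨fun z => Complex.log (ω) + l z - (Complex.log (-(ω * (z - q))) - Real.pi * Complex.I),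
    fun z => Complex.log ω + l z - Complex.log (ω * (z - q)), ?_, ?_, ?_, ?_, ?_, ?_⟩
  · refine (continuousOn_const.add (hl.mono Set.inter_subset_left)).sub
      ((ContinuousOn.clog (by fun_prop) fun z hz => hslit _ (neg_ne_zero.mpr (hne z hz.1)) ?_).sub
      continuousOn_const)
    have : (ω * z).re ≤ c := hz.2
    rw [mul_sub, Complex.neg_re, Complex.sub_re]
    linarith
  · refine (continuousOn_const.add (hl.mono Set.inter_subset_left)).sub
      (ContinuousOn.clog (by fun_prop) fun z hz => hslit _ (hne z hz.1) ?_)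
    have : c ≤ (ω * z).re := hz.2
    rw [mul_sub, Complex.sub_re]
    linarith
  · intro z hz
    have := hne z hz
    rw [Complex.exp_sub, Complex.exp_add, Complex.exp_sub, hle z hz, Complex.exp_log hω,
      Complex.exp_log (neg_ne_zero.mpr this), Complex.exp_pi_mul_I]
    field_simp
    exact div_self (right_ne_zero_of_mul this)
  · intro z hz
    have := hne z hz
    rw [Complex.exp_sub, Complex.exp_add, hle z hz, Complex.exp_log hω, Complex.exp_log this]
    field_simp
    exact div_self (right_ne_zero_of_mul this)
  · intro z hz hzc him
    have := log_neg_sub_log_of_neg (sub_neg.mpr him)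
    rw [← key z hzc] at this
    linear_combination -this
  · intro z hz hzc him
    have := log_neg_sub_log_of_pos (sub_pos.mpr him)
    rw [← key z hzc] at this
    linear_combination this

theorem eq_of_exp_eq_one_of_norm_sub_lt_one {a b : ℂ} (ha : Complex.exp a = 1)
    (hb : Complex.exp b = 1) (h : ‖a - b‖ < 1) : a = b := by
  obtain ⟨n, hn⟩ := Complex.exp_eq_one_iff.mp (show Complex.exp (a - b) = 1 by
    rw [Complex.exp_sub, ha, hb, div_one])
  rw [hn] at h
  have h2 : ‖(n : ℂ) * (2 * Real.pi * Complex.I)‖ = |(n : ℝ)| * (2 * Real.pi) := by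
    simp [abs_of_pos Real.pi_pos]
  rw [h2] at h
  have h3 : n = 0 := by
    by_contra h0
    have : (1 : ℝ) ≤ |(n : ℝ)| := by exact_mod_cast Int.one_le_abs h0
    nlinarith [Real.pi_gt_three]
  rw [h3, Int.cast_zero, zero_mul] at hn
  exact sub_eq_zero.mp hn

/-- One step of the gluing: logarithms on the two sides of the line `re (ω z) = c` that agree on
the line below height `T` can be changed so that they agree below height `T + δ`, where `δ` is a
scale at which their difference on the line is locally constant. -/
theorem IsTame.logs_agree_step {f : ℂ → ℂ} {Y : Set ℂ} (hY : IsTame Y) {ω : ℂ} (hω : ω ≠ 0)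
    {c δ T : ℝ}
    {h₁ h₂ : ℂ → ℂ} (c₁ : ContinuousOn h₁ (Y ∩ {z | (ω * z).re ≤ c}))
    (c₂ : ContinuousOn h₂ (Y ∩ {z | c ≤ (ω * z).re}))
    (e₁ : ∀ z ∈ Y ∩ {z | (ω * z).re ≤ c}, Complex.exp (h₁ z) = f z)
    (e₂ : ∀ z ∈ Y ∩ {z | c ≤ (ω * z).re}, Complex.exp (h₂ z) = f z)
    (hδ : ∀ z ∈ Y, ∀ w ∈ Y, (ω * z).re = c → (ω * w).re = c → |(ω * z).im - (ω * w).im| < δ →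
      h₂ z - h₁ z = h₂ w - h₁ w)
    (hT : ∀ z ∈ Y, (ω * z).re = c → (ω * z).im < T → h₁ z = h₂ z) :
    ∃ k₁ k₂ : ℂ → ℂ, ContinuousOn k₁ (Y ∩ {z | (ω * z).re ≤ c}) ∧
      ContinuousOn k₂ (Y ∩ {z | c ≤ (ω * z).re}) ∧
      (∀ z ∈ Y ∩ {z | (ω * z).re ≤ c}, Complex.exp (k₁ z) = f z) ∧
      (∀ z ∈ Y ∩ {z | c ≤ (ω * z).re}, Complex.exp (k₂ z) = f z) ∧
      (∀ z ∈ Y, ∀ w ∈ Y, (ω * z).re = c → (ω * w).re = c → |(ω * z).im - (ω * w).im| < δ →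
        k₂ z - k₁ z = k₂ w - k₁ w) ∧
      (∀ z ∈ Y, (ω * z).re = c → (ω * z).im < T + δ → k₁ z = k₂ z) := by
  by_cases hall : ∀ z ∈ Y, (ω * z).re = c → (ω * z).im < T + δ → h₁ z = h₂ z
  · exact ⟨h₁, h₂, c₁, c₂, e₁, e₂, hδ, hall⟩
  push Not at hall
  obtain ⟨b, hbY, hbc, hbT, hb⟩ := hall
  have hTb : T ≤ (ω * b).im := by
    by_contra h
    exact hb (hT b hbY hbc (not_le.mp h))
  -- No point of the line in `Y` has height in `(im (ω b) - δ, T)`, since `h₂ - h₁` would have to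
  -- take there both the value `0` and its value at `b`.
  have hgap : ∀ z ∈ Y, (ω * z).re = c → (ω * z).im < T → (ω * z).im ≤ (ω * b).im - δ := by
    intro z hz hzc hzT
    by_contra h
    have h1 := hδ z hz b hbY hzc hbc (by rw [abs_lt]; constructor <;> linarith)
    rw [hT z hz hzc hzT, sub_self] at h1
    exact hb (sub_eq_zero.mp h1.symm).symm
  obtain ⟨t, ht1, ht2⟩ := exists_between (show (ω * b).im - δ < T by linarith)
  set q : ℂ := ω⁻¹ * ⟨c, t⟩ with hqdef
  have hωq : ω * q = ⟨c, t⟩ := by rw [hqdef, mul_inv_cancel_left₀ hω]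
  have hq : q ∉ Y := by
    intro h
    have := hgap q h (by rw [hωq]) (by rw [hωq]; exact ht2)
    rw [hωq] at this
    exact absurd ht1 (not_lt.mpr this)
  obtain ⟨g₁, g₂, gc₁, gc₂, ge₁, ge₂, glow, ghigh⟩ := hY.exists_jump hω hq (by rw [hωq])
  rw [hωq] at glow ghigh
  obtain ⟨n, hn⟩ := Complex.exp_eq_one_iff.mp (show Complex.exp (h₂ b - h₁ b) = 1 by
    rw [Complex.exp_sub, e₁ b ⟨hbY, hbc.le⟩, e₂ b ⟨hbY, hbc.ge⟩, div_self]
    rw [← e₁ b ⟨hbY, hbc.le⟩]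
    exact Complex.exp_ne_zero _)
  have hlow : ∀ z ∈ Y, (ω * z).re = c → (ω * z).im < T →
      (h₂ z + n * g₂ z) - (h₁ z + n * g₁ z) = 0 := by
    intro z hz hzc hzT
    have := hgap z hz hzc hzT
    rw [hT z hz hzc hzT, glow z hz hzc (this.trans_lt ht1)]
    ring
  have hhigh : ∀ z ∈ Y, (ω * z).re = c → T ≤ (ω * z).im →
      (h₂ z + n * g₂ z) - (h₁ z + n * g₁ z) = (h₂ z - h₁ z) - (h₂ b - h₁ b) := by
    intro z hz hzc hzT
    have := ghigh z hz hzc (ht2.trans_le hzT)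
    rw [hn]
    linear_combination (n : ℂ) * this
  have hnear : ∀ z ∈ Y, (ω * z).re = c → T ≤ (ω * z).im → (ω * z).im < T + δ →
      h₂ z - h₁ z = h₂ b - h₁ b := by
    intro z hz hzc hzT hzT'
    exact hδ z hz b hbY hzc hbc (by rw [abs_lt]; constructor <;> linarith)
  refine ⟨fun z => h₁ z + n * g₁ z, fun z => h₂ z + n * g₂ z,
    c₁.add (continuousOn_const.mul gc₁), c₂.add (continuousOn_const.mul gc₂), ?_, ?_, ?_, ?_⟩
  · intro z hz
    rw [Complex.exp_add, Complex.exp_int_mul, ge₁ z hz.1, one_zpow, mul_one, e₁ z hz]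
  · intro z hz
    rw [Complex.exp_add, Complex.exp_int_mul, ge₂ z hz.1, one_zpow, mul_one, e₂ z hz]
  · -- by symmetry only pairs on different sides of height `T` need an argument
    have cross : ∀ z ∈ Y, ∀ w ∈ Y, (ω * z).re = c → (ω * w).re = c →
        |(ω * z).im - (ω * w).im| < δ → (ω * z).im < T → T ≤ (ω * w).im →
        (h₂ w + n * g₂ w) - (h₁ w + n * g₁ w) = 0 := by
      intro z hz w hw hzc hwc hzw hzT hwT
      rw [abs_lt] at hzw
      rw [hhigh w hw hwc hwT, hnear w hw hwc hwT (by linarith), sub_self]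
    intro z hz w hw hzc hwc hzw
    rcases lt_or_ge (ω * z).im T with hzT | hzT <;> rcases lt_or_ge (ω * w).im T with hwT | hwT
    · rw [hlow z hz hzc hzT, hlow w hw hwc hwT]
    · rw [hlow z hz hzc hzT, cross z hz w hw hzc hwc hzw hzT hwT]
    · rw [hlow w hw hwc hwT, cross w hw z hz hwc hzc (by rwa [abs_sub_comm]) hwT hzT]
    · rw [hhigh z hz hzc hzT, hhigh w hw hwc hwT, hδ z hz w hw hzc hwc hzw]
  · intro z hz hzc hzT
    refine (sub_eq_zero.mp ?_).symm
    rcases lt_or_ge (ω * z).im T with h | h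
    · exact hlow z hz hzc h
    · rw [hhigh z hz hzc h, hnear z hz hzc h hzT, sub_self]

/-- Logarithms on the two sides of a line can be combined on a tame set. -/
theorem IsTame.hasLogOn_of_halfPlanes {f : ℂ → ℂ} {Y : Set ℂ} (hY : IsTame Y) {ω : ℂ}
    (hω : ω ≠ 0) {c : ℝ} (H₁ : HasLogOn f (Y ∩ {z | (ω * z).re ≤ c}))
    (H₂ : HasLogOn f (Y ∩ {z | c ≤ (ω * z).re})) : HasLogOn f Y := by
  obtain ⟨h₁, c₁, e₁⟩ := H₁
  obtain ⟨h₂, c₂, e₂⟩ := H₂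
  have hEc : IsCompact (Y ∩ {z | (ω * z).re = c}) :=
    hY.1.inter_right (isClosed_eq (by fun_prop) continuous_const)
  have hdc : ContinuousOn (fun z => h₂ z - h₁ z) (Y ∩ {z | (ω * z).re = c}) :=
    (c₂.mono fun z hz => ⟨hz.1, (show (ω * z).re = c from hz.2).ge⟩).sub
      (c₁.mono fun z hz => ⟨hz.1, (show (ω * z).re = c from hz.2).le⟩)
  have hd1 : ∀ z ∈ Y, (ω * z).re = c → Complex.exp (h₂ z - h₁ z) = 1 := by
    intro z hz hzc
    rw [Complex.exp_sub, e₁ z ⟨hz, hzc.le⟩, e₂ z ⟨hz, hzc.ge⟩, div_self]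
    rw [← e₁ z ⟨hz, hzc.le⟩]
    exact Complex.exp_ne_zero _
  obtain ⟨δ, hδ0, hδ⟩ := Metric.uniformContinuousOn_iff.mp
    (hEc.uniformContinuousOn_of_continuous hdc) 1 one_pos
  have hδ' : ∀ z ∈ Y, ∀ w ∈ Y, (ω * z).re = c → (ω * w).re = c →
      |(ω * z).im - (ω * w).im| < ‖ω‖ * δ → h₂ z - h₁ z = h₂ w - h₁ w := by
    intro z hz w hw hzc hwc hzw
    refine eq_of_exp_eq_one_of_norm_sub_lt_one (hd1 z hz hzc) (hd1 w hw hwc) ?_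
    have := hδ z ⟨hz, hzc⟩ w ⟨hw, hwc⟩ ?_
    · rwa [dist_eq_norm] at this
    · have h1 : ω * (z - w) = (((ω * z).im - (ω * w).im : ℝ) : ℂ) * Complex.I := by
        apply Complex.ext
        · rw [mul_sub, Complex.sub_re, hzc, hwc]; simp
        · rw [mul_sub, Complex.sub_im]; simp
      have h2 := congrArg norm h1
      rw [norm_mul, norm_mul, Complex.norm_I, mul_one, Complex.norm_real, Real.norm_eq_abs] at h2
      rw [dist_eq_norm]
      rw [← h2] at hzw
      exact lt_of_mul_lt_mul_left hzw (norm_nonneg _)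
  have hpos : 0 < ‖ω‖ * δ := mul_pos (norm_pos_iff.mpr hω) hδ0
  obtain ⟨R, hR⟩ := hY.1.isBounded.exists_norm_le
  have him : ∀ z ∈ Y, |(ω * z).im| ≤ ‖ω‖ * R := fun z hz =>
    (Complex.abs_im_le_norm _).trans (by
      rw [norm_mul]; exact mul_le_mul_of_nonneg_left (hR z hz) (norm_nonneg _))
  have main : ∀ n : ℕ, ∃ k₁ k₂ : ℂ → ℂ, ContinuousOn k₁ (Y ∩ {z | (ω * z).re ≤ c}) ∧
      ContinuousOn k₂ (Y ∩ {z | c ≤ (ω * z).re}) ∧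
      (∀ z ∈ Y ∩ {z | (ω * z).re ≤ c}, Complex.exp (k₁ z) = f z) ∧
      (∀ z ∈ Y ∩ {z | c ≤ (ω * z).re}, Complex.exp (k₂ z) = f z) ∧
      (∀ z ∈ Y, ∀ w ∈ Y, (ω * z).re = c → (ω * w).re = c →
        |(ω * z).im - (ω * w).im| < ‖ω‖ * δ → k₂ z - k₁ z = k₂ w - k₁ w) ∧
      (∀ z ∈ Y, (ω * z).re = c → (ω * z).im < -(‖ω‖ * R) + n * (‖ω‖ * δ) → k₁ z = k₂ z) := by
    intro n
    induction n with
    | zero =>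
      refine ⟨h₁, h₂, c₁, c₂, e₁, e₂, hδ', fun z hz _ h => absurd h (not_lt.mpr ?_)⟩
      have := (abs_le.mp (him z hz)).1
      simpa using this
    | succ n ih =>
      obtain ⟨k₁, k₂, kc₁, kc₂, ke₁, ke₂, kδ, kT⟩ := ih
      have := hY.logs_agree_step hω kc₁ kc₂ ke₁ ke₂ kδ kT
      convert this using 14
      push_cast
      ring
  obtain ⟨n, hn⟩ := exists_nat_gt ((2 * (‖ω‖ * R)) / (‖ω‖ * δ))
  rw [div_lt_iff₀ hpos] at hn
  obtain ⟨k₁, k₂, kc₁, kc₂, ke₁, ke₂, -, kT⟩ := main n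
  have hYc := hY.1.isClosed
  have := hasLogOn_union (hYc.inter (isClosed_le (by fun_prop) continuous_const))
    (hYc.inter (isClosed_le continuous_const (by fun_prop))) kc₁ kc₂ ke₁ ke₂
    fun z hz1 hz2 => kT z hz1.1 (le_antisymm hz1.2 hz2.2)
      (by linarith [(abs_le.mp (him z hz1.1)).2])
  refine this.mono fun z hz => ?_
  rcases le_total (ω * z).re c with h | h
  · exact Or.inl ⟨hz, h⟩
  · exact Or.inr ⟨hz, h⟩

/-- If every tame subset of width at most `δ` in the direction `ω` carries a logarithm of `f`, then
so does the whole tame set. -/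
theorem IsTame.hasLogOn_of_narrow {f : ℂ → ℂ} {Y : Set ℂ} (hY : IsTame Y) {ω : ℂ} (hω : ω ≠ 0)
    {δ : ℝ} (hδ : 0 < δ)
    (H : ∀ Z ⊆ Y, IsTame Z → (∀ z ∈ Z, ∀ w ∈ Z, |(ω * z).re - (ω * w).re| ≤ δ) → HasLogOn f Z) :
    HasLogOn f Y := by
  obtain ⟨R, hR⟩ := hY.1.isBounded.exists_norm_le
  have hre : ∀ z ∈ Y, |(ω * z).re| ≤ ‖ω‖ * R := fun z hz =>
    (Complex.abs_re_le_norm _).trans (by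
      rw [norm_mul]; exact mul_le_mul_of_nonneg_left (hR z hz) (norm_nonneg _))
  have main : ∀ n : ℕ,
      HasLogOn f (Y ∩ {z | (ω * z).re ≤ -(‖ω‖ * R) + n * δ}) := by
    intro n
    induction n with
    | zero =>
      refine H _ Set.inter_subset_left (hY.inter_halfPlane hω _) fun z hz w hw => ?_
      have h1 : (ω * z).re ≤ -(‖ω‖ * R) + (0 : ℕ) * δ := hz.2
      have h2 : (ω * w).re ≤ -(‖ω‖ * R) + (0 : ℕ) * δ := hw.2
      have h3 := (abs_le.mp (hre z hz.1)).1
      have h4 := (abs_le.mp (hre w hw.1)).1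
      rw [Nat.cast_zero, zero_mul] at h1 h2
      rw [abs_le]
      constructor <;> linarith
    | succ n ih =>
      have hY' := hY.inter_halfPlane hω (-(‖ω‖ * R) + (n + 1 : ℕ) * δ)
      refine hY'.hasLogOn_of_halfPlanes hω (c := -(‖ω‖ * R) + n * δ)
        (ih.mono fun z hz => ⟨hz.1.1, hz.2⟩)
        (H _ (fun z hz => hz.1.1) (hY'.inter_halfPlane' hω _) fun z hz w hw => ?_)
      have h1 : (ω * z).re ≤ -(‖ω‖ * R) + (n + 1 : ℕ) * δ := hz.1.2
      have h2 : (ω * w).re ≤ -(‖ω‖ * R) + (n + 1 : ℕ) * δ := hw.1.2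
      have h3 : -(‖ω‖ * R) + n * δ ≤ (ω * z).re := hz.2
      have h4 : -(‖ω‖ * R) + n * δ ≤ (ω * w).re := hw.2
      push_cast at h1 h2
      rw [abs_le]
      constructor <;> linarith
  obtain ⟨n, hn⟩ := exists_nat_gt ((2 * (‖ω‖ * R)) / δ)
  rw [div_lt_iff₀ hδ] at hn
  refine (main n).mono fun z hz => ⟨hz, ?_⟩
  have := (abs_le.mp (hre z hz)).2
  show (ω * z).re ≤ _
  linarith

/-- On a tame set every non-vanishing continuous function has a continuous logarithm. -/
theorem IsTame.hasLogOn {f : ℂ → ℂ} {Y : Set ℂ} (hY : IsTame Y) (hf : ContinuousOn f Y)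
    (h0 : ∀ z ∈ Y, f z ≠ 0) : HasLogOn f Y := by
  rcases Y.eq_empty_or_nonempty with rfl | hne
  · exact ⟨0, continuousOn_empty _, fun z hz => hz.elim⟩
  obtain ⟨x, hx, hmin⟩ := hY.1.exists_isMinOn hne hf.norm
  have hm : 0 < ‖f x‖ := norm_pos_iff.mpr (h0 x hx)
  obtain ⟨δ, hδ0, hδ⟩ := Metric.uniformContinuousOn_iff.mp
    (hY.1.uniformContinuousOn_of_continuous hf) _ hm
  refine hY.hasLogOn_of_narrow one_ne_zero (δ := δ / 3) (by positivity) fun Z hZY hZ hZre => ?_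
  refine hZ.hasLogOn_of_narrow Complex.I_ne_zero (δ := δ / 3) (by positivity)
    fun W hWZ hW hWim => ?_
  rcases W.eq_empty_or_nonempty with rfl | ⟨w, hw⟩
  · exact ⟨0, continuousOn_empty _, fun z hz => hz.elim⟩
  have hwY := hZY (hWZ hw)
  have h1 : HasLogOn (fun z => f z / f w) W := by
    refine hasLogOn_of_mem_slitPlane ((hf.mono (hWZ.trans hZY)).div_const _) fun z hz => ?_
    refine mem_slitPlane_of_norm_sub_one_lt ?_
    have hd : dist z w < δ := by
      have a1 := hZre z (hWZ hz) w (hWZ hw)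
      have a2 := hWim z hz w hw
      simp only [one_mul, Complex.mul_re, Complex.I_re, Complex.I_im, zero_mul, zero_sub] at a1 a2
      rw [dist_eq_norm]
      refine (Complex.norm_le_abs_re_add_abs_im _).trans_lt ?_
      rw [Complex.sub_re, Complex.sub_im]
      have : |z.im - w.im| ≤ δ / 3 := by
        rw [← abs_neg]; convert a2 using 2; ring
      linarith
    have h2 := hδ z (hZY (hWZ hz)) w hwY hd
    rw [div_sub_one (h0 w hwY), norm_div, div_lt_one (norm_pos_iff.mpr (h0 w hwY))]
    rw [dist_eq_norm] at h2
    exact h2.trans_le (hmin hwY)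
  refine (h1.mul (hasLogOn_const (h0 w hwY) W)).congr fun z _ => ?_
  exact div_mul_cancel₀ _ (h0 w hwY)

/-! ### Janiszewski's theorem -/

theorem HasLogOn.inv {f : ℂ → ℂ} {Y : Set ℂ} (hf : HasLogOn f Y) :
    HasLogOn (fun z => (f z)⁻¹) Y := by
  obtain ⟨l, hl, he⟩ := hf
  exact ⟨fun z => -l z, hl.neg, fun z hz => by rw [Complex.exp_neg, he z hz]⟩

/-- A compact plane set is tame if its complement has no bounded component: the set of `q` for
which `z - q` has a logarithm is open and closed in the complement, and contains all large `q`. -/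
theorem isTame_of_unbounded_compl {X : Set ℂ} (hX : IsCompact X)
    (H : ∀ q ∉ X, ∃ D : Set ℂ, IsPreconnected D ∧ q ∈ D ∧ D ⊆ Xᶜ ∧ ¬ Bornology.IsBounded D) :
    IsTame X := by
  refine ⟨hX, fun q hq => ?_⟩
  obtain ⟨D, hD, hqD, hDX, hDb⟩ := H q hq
  obtain ⟨R, hR⟩ := hX.isBounded.exists_norm_le
  obtain ⟨p, hpD, hp⟩ : ∃ p ∈ D, max R 0 < ‖p‖ := by
    by_contra! h
    exact hDb ((Metric.isBounded_closedBall (x := (0 : ℂ)) (r := max R 0)).subset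
      fun z hz => mem_closedBall_zero_iff.mpr (h z hz))
  have hp0 : 0 < ‖p‖ := (le_max_right _ _).trans_lt hp
  have hpl : HasLogOn (fun z => z - p) X := by
    have : HasLogOn (fun z => 1 - z / p) X := by
      refine hasLogOn_of_mem_slitPlane (by fun_prop) fun z hz =>
        mem_slitPlane_of_norm_sub_one_lt ?_
      rw [show 1 - z / p - 1 = -(z / p) by ring, norm_neg, norm_div, div_lt_one hp0]
      exact (hR z hz).trans_lt ((le_max_left _ _).trans_lt hp)
    refine (this.mul (hasLogOn_const (neg_ne_zero.mpr (norm_pos_iff.mp hp0)) X)).congr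
      fun z _ => ?_
    have := norm_pos_iff.mp hp0
    field_simp
    ring
  have key := hD.induction₂
    (fun x y => HasLogOn (fun z => z - x) X ↔ HasLogOn (fun z => z - y) X) (fun x hx => ?_)
    (fun _ _ _ _ _ _ h h' => h.trans h') (fun _ _ _ _ h => h.symm) hpD hqD
  · exact key.mp hpl
  · obtain ⟨ε, hε, hball⟩ := Metric.isOpen_iff.mp hX.isClosed.isOpen_compl x (hDX hx)
    filter_upwards [nhdsWithin_le_nhds (Metric.ball_mem_nhds x hε)] with y hy
    have hne : ∀ z ∈ X, z - x ≠ 0 := fun z hz h => hDX hx (sub_eq_zero.mp h ▸ hz)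
    have hne' : ∀ z ∈ X, z - y ≠ 0 := fun z hz h => hball hy (sub_eq_zero.mp h ▸ hz)
    have hq : HasLogOn (fun z => (z - y) / (z - x)) X := by
      refine hasLogOn_of_mem_slitPlane (ContinuousOn.div (by fun_prop) (by fun_prop) hne)
        fun z hz => mem_slitPlane_of_norm_sub_one_lt ?_
      rw [div_sub_one (hne z hz), norm_div, div_lt_one (norm_pos_iff.mpr (hne z hz)),
        show z - y - (z - x) = -(y - x) by ring, norm_neg]
      rw [mem_ball_iff_norm] at hy
      refine hy.trans_le ?_
      by_contra h
      exact hball (mem_ball_iff_norm.mpr (not_le.mp h)) hz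
    constructor
    · intro h
      exact (h.mul hq).congr fun z hz => mul_div_cancel₀ _ (hne z hz)
    · intro h
      refine (h.mul hq.inv).congr fun z hz => ?_
      have := hne z hz
      have := hne' z hz
      simp only
      field_simp

theorem IsPreconnected.eq_of_mapsTo_countable {X Y : Type*} [TopologicalSpace X] [MetricSpace Y]
    {S : Set X} (hS : IsPreconnected S) {f : X → Y} (hf : ContinuousOn f S) {C : Set Y}
    (hC : C.Countable) (hfC : Set.MapsTo f S C) {x y : X} (hx : x ∈ S) (hy : y ∈ S) :
    f x = f y :=
  hC.isTotallyDisconnected _ hfC.image_subset (hS.image f hf) (Set.mem_image_of_mem f hx)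
    (Set.mem_image_of_mem f hy)

theorem countable_exp_eq_one : {z : ℂ | Complex.exp z = 1}.Countable := by
  refine (Set.countable_range fun n : ℤ => (n : ℂ) * (2 * Real.pi * Complex.I)).mono ?_
  intro z hz
  obtain ⟨n, hn⟩ := Complex.exp_eq_one_iff.mp hz
  exact ⟨n, hn.symm⟩

/-- If the union of two continua has no bounded complementary component, their intersection is
connected: were it the union of disjoint closed sets `A` and `B`, the function equal to
`exp (2πi u)` on the first continuum, with `u = 0` on `A` and `u = 1` on `B`, and equal to `1` on
the second, would have no logarithm. -/
theorem IsTame.isPreconnected_inter {K L : Set ℂ} (hKc : IsClosed K) (hLc : IsClosed L)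
    (hK : IsPreconnected K) (hL : IsPreconnected L) (h : IsTame (K ∪ L)) :
    IsPreconnected (K ∩ L) := by
  classical
  rw [isPreconnected_closed_iff]
  rintro A B hA hB hcov ⟨a, ha, haA⟩ ⟨b, hb, hbB⟩
  by_contra hemp
  rw [Set.not_nonempty_iff_eq_empty] at hemp
  obtain ⟨u, huA, huB, -⟩ := exists_continuous_zero_one_of_isClosed
    ((hKc.inter hLc).inter hA) ((hKc.inter hLc).inter hB) (by
      rw [Set.disjoint_iff_inter_eq_empty, ← hemp]
      ext z; simp only [Set.mem_inter_iff]; tauto)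
  have hexp : ∀ z ∈ K ∩ L, Complex.exp (2 * Real.pi * Complex.I * (u z : ℂ)) = 1 := by
    intro z hz
    rcases hcov hz with h | h
    · rw [huA ⟨hz, h⟩]; simp
    · rw [huB ⟨hz, h⟩]; simp
  set f : ℂ → ℂ := fun z => if z ∈ L then 1 else Complex.exp (2 * Real.pi * Complex.I * (u z : ℂ))
    with hf
  have hfL : ∀ z ∈ L, f z = 1 := fun z hz => by simp [hf, hz]
  have hfK : ∀ z ∈ K, f z = Complex.exp (2 * Real.pi * Complex.I * (u z : ℂ)) := by
    intro z hz
    by_cases hzL : z ∈ L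
    · rw [hfL z hzL, hexp z ⟨hz, hzL⟩]
    · simp [hf, hzL]
  have hfc : ContinuousOn f (K ∪ L) := by
    refine ContinuousOn.union_of_isClosed ?_ ?_ hKc hLc
    · exact ContinuousOn.congr (by fun_prop) hfK
    · exact continuousOn_const.congr hfL
  obtain ⟨l, hl, hle⟩ := h.hasLogOn hfc fun z _ => by
    simp only [hf]; split_ifs
    · exact one_ne_zero
    · exact Complex.exp_ne_zero _
  have hlL : l a = l b := hL.eq_of_mapsTo_countable (hl.mono Set.subset_union_right)
    countable_exp_eq_one (fun z hz => (hle z (Or.inr hz)).trans (hfL z hz)) ha.2 hb.2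
  have hlK := hK.eq_of_mapsTo_countable (f := fun z => l z - 2 * Real.pi * Complex.I * (u z : ℂ))
    ((hl.mono Set.subset_union_left).sub (by fun_prop)) countable_exp_eq_one (fun z hz => by
      show Complex.exp _ = 1
      rw [Complex.exp_sub, hle z (Or.inl hz), hfK z hz, div_self (Complex.exp_ne_zero _)])
    ha.1 hb.1
  have hua : u a = 0 := huA ⟨ha, haA⟩
  have hub : u b = 1 := huB ⟨hb, hbB⟩
  have h2 : (2 * Real.pi * Complex.I : ℂ) = 0 := by
    simp only [hlL, hua, hub] at hlK
    push_cast at hlK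
    linear_combination hlK
  exact Complex.two_pi_I_ne_zero h2

/-- A Janiszewski theorem: if the complement of the union of two plane continua has no bounded
component, then the intersection of the continua is connected. -/
theorem isPreconnected_inter_of_unbounded_compl {K L : Set (ℝ × ℝ)} (hKc : IsCompact K)
    (hLc : IsCompact L) (hK : IsPreconnected K) (hL : IsPreconnected L)
    (H : ∀ q ∉ K ∪ L, ∃ D : Set (ℝ × ℝ), IsPreconnected D ∧ q ∈ D ∧ D ⊆ (K ∪ L)ᶜ ∧
      ¬ Bornology.IsBounded D) :
    IsPreconnected (K ∩ L) := by
  set e := Complex.equivRealProdCLM.symm with he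
  have hbdd : ∀ D : Set (ℝ × ℝ), Bornology.IsBounded (e '' D) → Bornology.IsBounded D := by
    intro D hD
    have := e.symm.toContinuousLinearMap.lipschitz.isBounded_image hD
    rw [Set.image_image] at this
    simpa using this
  have ht : IsTame (e '' K ∪ e '' L) := by
    rw [← Set.image_union]
    refine isTame_of_unbounded_compl ((hKc.union hLc).image e.continuous) fun q hq => ?_
    obtain ⟨p, rfl⟩ := e.surjective q
    rw [e.injective.mem_set_image] at hq
    obtain ⟨D, hD, hpD, hDX, hDb⟩ := H p hq
    refine ⟨e '' D, hD.image _ e.continuous.continuousOn, Set.mem_image_of_mem _ hpD, ?_,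
      fun h => hDb (hbdd D h)⟩
    rw [← Set.image_compl_eq e.bijective]
    exact Set.image_mono hDX
  have := ht.isPreconnected_inter (hKc.image e.continuous).isClosed
    (hLc.image e.continuous).isClosed (hK.image _ e.continuous.continuousOn)
    (hL.image _ e.continuous.continuousOn)
  rw [← Set.image_inter e.injective] at this
  exact e.toHomeomorph.isPreconnected_image.mp this

/-! ### Bounded diameters of the iterates of a generator -/

/-- In a closed thin set whose complement has only unbounded components, two subcontinua meet in a
connected set. -/
theorem isPreconnected_inter_of_subset_thin {S K L : Set (ℝ × ℝ)} (hS : interior S = ∅)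
    (hunb : ∀ p ∉ S, ∃ D : Set (ℝ × ℝ), IsPreconnected D ∧ p ∈ D ∧ D ⊆ Sᶜ ∧
      ¬ Bornology.IsBounded D)
    (hKc : IsCompact K) (hLc : IsCompact L) (hK : IsPreconnected K) (hL : IsPreconnected L)
    (hKS : K ⊆ S) (hLS : L ⊆ S) : IsPreconnected (K ∩ L) := by
  refine isPreconnected_inter_of_unbounded_compl hKc hLc hK hL fun q hq => ?_
  have hsub : Sᶜ ⊆ (K ∪ L)ᶜ := Set.compl_subset_compl.mpr (Set.union_subset hKS hLS)
  obtain ⟨ε, hε, hball⟩ := Metric.isOpen_iff.mp (hKc.union hLc).isClosed.isOpen_compl q hq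
  obtain ⟨p, hpb, hpS⟩ : ∃ p ∈ Metric.ball q ε, p ∉ S := by
    by_contra! h
    have : q ∈ interior S := mem_interior.mpr ⟨_, h, Metric.isOpen_ball, Metric.mem_ball_self hε⟩
    rw [hS] at this
    exact this
  obtain ⟨D, hD, hpD, hDS, hDb⟩ := hunb p hpS
  exact ⟨Metric.ball q ε ∪ D, (convex_ball q ε).isPreconnected.union p hpb hpD hD,
    Or.inl (Metric.mem_ball_self hε), Set.union_subset hball (hDS.trans hsub),
    fun h => hDb (h.subset Set.subset_union_right)⟩

theorem iterate_add_of_comm {F : ℝ × ℝ → ℝ × ℝ} {m : ℝ × ℝ} (h : ∀ z, F (z + m) = F z + m)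
    (n : ℕ) (z : ℝ × ℝ) : F^[n] (z + m) = F^[n] z + m := by
  induction n generalizing z with
  | zero => rfl
  | succ n ih => rw [Function.iterate_succ_apply, Function.iterate_succ_apply, h, ih]

/-- Consecutive translates of `G` by multiples of `v` chain up to a continuum containing `G` and
`G + N v`, provided that `G` meets `G + v`. -/
theorem exists_continuum_chain {G S : Set (ℝ × ℝ)} {v : ℝ × ℝ} (hGc : IsCompact G)
    (hG : IsPreconnected G) (hv : ∃ x ∈ G, x + v ∈ G)
    (hS : ∀ j : ℕ, ∀ x ∈ G, x + j • v ∈ S) (N : ℕ) :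
    ∃ P : Set (ℝ × ℝ), IsCompact P ∧ IsPreconnected P ∧ P ⊆ S ∧ G ⊆ P ∧
      ∀ x ∈ G, x + N • v ∈ P := by
  induction N with
  | zero =>
    refine ⟨G, hGc, hG, fun x hx => by simpa using hS 0 x hx, subset_rfl, fun x hx => by simpa⟩
  | succ N ih =>
    obtain ⟨P, hPc, hP, hPS, hGP, hPN⟩ := ih
    obtain ⟨x, hx, hxv⟩ := hv
    have hcont : Continuous fun z : ℝ × ℝ => z + (N + 1) • v := by fun_prop
    refine ⟨P ∪ (fun z => z + (N + 1) • v) '' G, hPc.union (hGc.image hcont),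
      hP.union (x + (N + 1) • v) ?_ (Set.mem_image_of_mem _ hx)
        (hG.image _ hcont.continuousOn), Set.union_subset hPS ?_,
      hGP.trans Set.subset_union_left, fun y hy => Or.inr (Set.mem_image_of_mem _ hy)⟩
    · have := hPN _ hxv
      rwa [add_assoc, ← succ_nsmul'] at this
    · rintro _ ⟨y, hy, rfl⟩
      exact hS _ y hy

/-- The data of an invariant compactly generated set in the plane: `S` is the union of the
translates of the continuum `G` under the discrete group `Λ`, it is thin, its complement has only
unbounded components, and the continuous injective map `F` commutes with `Λ` and maps `S` to
itself. -/
structure IsGeneratedInvariant (Λ : AddSubgroup (ℝ × ℝ)) (F : ℝ × ℝ → ℝ × ℝ)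
    (S G : Set (ℝ × ℝ)) : Prop where
  finite_le : ∀ R : ℝ, {m : ℝ × ℝ | m ∈ Λ ∧ ‖m‖ ≤ R}.Finite
  continuous : Continuous F
  injective : Function.Injective F
  map_add : ∀ m ∈ Λ, ∀ z, F (z + m) = F z + m
  mapsTo : Set.MapsTo F S S
  isCompact : IsCompact G
  isConnected : IsConnected G
  mem_iff : ∀ z, z ∈ S ↔ ∃ x ∈ G, ∃ m ∈ Λ, x + m = z
  thin : interior S = ∅
  unbounded : ∀ p ∉ S, ∃ D : Set (ℝ × ℝ), IsPreconnected D ∧ p ∈ D ∧ D ⊆ Sᶜ ∧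
    ¬ Bornology.IsBounded D

namespace IsGeneratedInvariant

variable {Λ : AddSubgroup (ℝ × ℝ)} {F : ℝ × ℝ → ℝ × ℝ} {S G : Set (ℝ × ℝ)}

theorem add_mem (h : IsGeneratedInvariant Λ F S G) {x m : ℝ × ℝ} (hx : x ∈ S) (hm : m ∈ Λ) :
    x + m ∈ S := by
  obtain ⟨y, hy, k, hk, rfl⟩ := (h.mem_iff x).mp hx
  exact (h.mem_iff _).mpr ⟨y, hy, k + m, Λ.add_mem hk hm, by rw [add_assoc]⟩

theorem subset (h : IsGeneratedInvariant Λ F S G) : G ⊆ S := fun x hx =>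
  (h.mem_iff x).mpr ⟨x, hx, 0, Λ.zero_mem, add_zero x⟩

/-- If `G` is disjoint from its translates, then each `Fⁿ(G)` lies in a single translate. -/
theorem bounded_of_disjoint (h : IsGeneratedInvariant Λ F S G)
    (hd : ∀ v ∈ Λ, v ≠ 0 → ∀ x ∈ G, x + v ∉ G) :
    ∃ C : ℝ, ∀ n : ℕ, ∀ x ∈ G, ∀ y ∈ G, ‖F^[n] x - F^[n] y‖ ≤ C := by
  obtain ⟨R, hR⟩ := h.isCompact.isBounded.exists_norm_le
  refine ⟨2 * R, fun n x hx y hy => ?_⟩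
  have hFn : Continuous F^[n] := h.continuous.iterate n
  obtain ⟨R', hR'⟩ := (h.isCompact.image hFn).isBounded.exists_norm_le
  obtain ⟨a, ha, m, hm, ham⟩ := (h.mem_iff _).mp (h.mapsTo.iterate n (h.subset hx))
  obtain ⟨b, hb, k, hk, hbk⟩ := (h.mem_iff _).mp (h.mapsTo.iterate n (h.subset hy))
  by_cases hmk : m = k
  · rw [← ham, ← hbk, hmk, add_sub_add_right_eq_sub]
    linarith [norm_sub_le a b, hR a ha, hR b hb]
  exfalso
  have hcl : ∀ v : ℝ × ℝ, IsClosed ((fun z => z + v) '' G) := fun v =>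
    (h.isCompact.image (by fun_prop)).isClosed
  have hfin : {v : ℝ × ℝ | (v ∈ Λ ∧ ‖v‖ ≤ R' + R) ∧ v ≠ m}.Finite :=
    (h.finite_le (R' + R)).subset fun v hv => hv.1
  have hmem : ∀ c ∈ G, ∀ v ∈ Λ, v ≠ m → c + v ∈ F^[n] '' G →
      c + v ∈ ⋃ v ∈ {v : ℝ × ℝ | (v ∈ Λ ∧ ‖v‖ ≤ R' + R) ∧ v ≠ m}, (fun z => z + v) '' G := by
    intro c hc v hv hvm hcv
    refine Set.mem_biUnion (x := v) ⟨⟨hv, ?_⟩, hvm⟩ (Set.mem_image_of_mem _ hc)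
    have := norm_sub_le (c + v) c
    rw [add_sub_cancel_left] at this
    linarith [hR' _ hcv, hR c hc]
  have hpre := isPreconnected_closed_iff.mp (h.isConnected.isPreconnected.image _ hFn.continuousOn)
    _ _ (hcl m) (hfin.isClosed_biUnion fun v _ => hcl v) ?_
    ⟨F^[n] x, Set.mem_image_of_mem _ hx, a, ha, ham⟩
    ⟨F^[n] y, Set.mem_image_of_mem _ hy, by
      have := hmem b hb k hk (Ne.symm hmk) (hbk ▸ Set.mem_image_of_mem _ hy)
      rwa [hbk] at this⟩
  · obtain ⟨z, -, ⟨c, hc, hcz⟩, hz⟩ := hpre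
    simp only [Set.mem_iUnion, Set.mem_image, Set.mem_ofPred_eq] at hz hcz
    obtain ⟨v, ⟨⟨hv, -⟩, hvm⟩, d, hdG, hdz⟩ := hz
    refine hd (m - v) (Λ.sub_mem hm hv) (sub_ne_zero.mpr (Ne.symm hvm)) c hc ?_
    rwa [← add_sub_assoc, hcz, ← hdz, add_sub_cancel_right]
  · rintro _ ⟨w, hw, rfl⟩
    obtain ⟨c, hc, v, hv, hcv⟩ := (h.mem_iff _).mp (h.mapsTo.iterate n (h.subset hw))
    by_cases hvm : v = m
    · exact Or.inl ⟨c, hc, by rw [← hcv, hvm]⟩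
    · right
      rw [← hcv]
      exact hmem c hc v hv hvm (hcv ▸ Set.mem_image_of_mem _ hw)

/-- If `G` meets a translate `G + v` with `v ≠ 0`, then the diameters of the sets `Fⁿ(G)` are
bounded. Otherwise some `H = Fⁿ(G)`, which is disjoint from `H + N v` for a fixed large `N`, is so
wide that two disjoint translates of a chain of copies of `G` each meet both `H` and `H + N v`. The
four continua enclose a bounded region, which is impossible in `S`. -/
theorem bounded_of_meets (h : IsGeneratedInvariant Λ F S G) {v : ℝ × ℝ} (hvΛ : v ∈ Λ)
    (hv0 : v ≠ 0) (hv : ∃ x ∈ G, x + v ∈ G) :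
    ∃ C : ℝ, ∀ n : ℕ, ∀ x ∈ G, ∀ y ∈ G, ‖F^[n] x - F^[n] y‖ ≤ C := by
  obtain ⟨R, hR⟩ := h.isCompact.isBounded.exists_norm_le
  obtain ⟨N, hN⟩ := exists_nat_gt (2 * R / ‖v‖)
  rw [div_lt_iff₀ (norm_pos_iff.mpr hv0)] at hN
  have hNv : N • v ∈ Λ := Λ.nsmul_mem hvΛ N
  have hNnorm : ‖N • v‖ = N * ‖v‖ := by
    rw [← Nat.cast_smul_eq_nsmul ℝ, norm_smul, Real.norm_natCast]
  obtain ⟨P, hPc, hP, hPS, hGP, hPN⟩ := exists_continuum_chain h.isCompact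
    h.isConnected.isPreconnected hv
    (fun j x hx => h.add_mem (h.subset hx) (Λ.nsmul_mem hvΛ j)) N
  obtain ⟨R₀, hR₀⟩ := hPc.isBounded.exists_norm_le
  refine ⟨4 * R₀, fun n x hx y hy => ?_⟩
  by_contra! hwide
  have hFn : Continuous F^[n] := h.continuous.iterate n
  have hadd : ∀ m ∈ Λ, ∀ z, F^[n] (z + m) = F^[n] z + m := fun m hm z =>
    iterate_add_of_comm (h.map_add m hm) n z
  have hmaps : ∀ z ∈ G, F^[n] z ∈ S := fun z hz => h.mapsTo.iterate n (h.subset hz)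
  have htr : ∀ m : ℝ × ℝ, Continuous fun z : ℝ × ℝ => z + m := fun m => by fun_prop
  obtain ⟨a, ha, m, hm, ham⟩ := (h.mem_iff _).mp (hmaps x hx)
  obtain ⟨b, hb, k, hk, hbk⟩ := (h.mem_iff _).mp (hmaps y hy)
  set H := F^[n] '' G with hH
  set H' := (fun z => z + N • v) '' H with hH'
  set Pm := (fun z => z + m) '' P with hPm
  set Pk := (fun z => z + k) '' P with hPk
  have hHc : IsCompact H := h.isCompact.image hFn
  have hHp : IsPreconnected H := h.isConnected.isPreconnected.image _ hFn.continuousOn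
  have hxH : F^[n] x ∈ H := Set.mem_image_of_mem _ hx
  have hyH : F^[n] y ∈ H := Set.mem_image_of_mem _ hy
  have hxP : F^[n] x ∈ Pm := ⟨a, hGP ha, ham⟩
  have hyP : F^[n] y ∈ Pk := ⟨b, hGP hb, hbk⟩
  have hxP' : F^[n] x + N • v ∈ Pm :=
    ⟨a + N • v, hPN a ha, by simp only [← ham]; abel⟩
  have hyP' : F^[n] y + N • v ∈ Pk :=
    ⟨b + N • v, hPN b hb, by simp only [← hbk]; abel⟩
  have hdisj : ∀ z ∈ H, z ∉ H' := by
    rintro _ ⟨c, hc, rfl⟩ ⟨_, ⟨d, hd, rfl⟩, hcd⟩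
    simp only at hcd
    rw [← hadd _ hNv] at hcd
    have h1 := h.injective.iterate n hcd
    have h2 := norm_sub_le c d
    rw [← h1, add_sub_cancel_left, hNnorm, h1] at h2
    linarith [hR c hc, hR d hd]
  have hHS : H ⊆ S := Set.image_subset_iff.mpr hmaps
  have hH'S : H' ⊆ S := Set.image_subset_iff.mpr fun z hz => h.add_mem (hHS hz) hNv
  have hPmS : Pm ⊆ S := Set.image_subset_iff.mpr fun z hz => h.add_mem (hPS hz) hm
  have hPkS : Pk ⊆ S := Set.image_subset_iff.mpr fun z hz => h.add_mem (hPS hz) hk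
  have hPmc : IsCompact Pm := hPc.image (htr m)
  have hPkc : IsCompact Pk := hPc.image (htr k)
  have hpre := isPreconnected_inter_of_subset_thin h.thin h.unbounded
    (hHc.union hPmc) ((hHc.image (htr (N • v))).union hPkc)
    (hHp.union _ hxH hxP (hP.image _ (htr m).continuousOn))
    ((hHp.image _ (htr (N • v)).continuousOn).union _ (Set.mem_image_of_mem _ hyH) hyP'
      (hP.image _ (htr k).continuousOn))
    (Set.union_subset hHS hPmS) (Set.union_subset hH'S hPkS)
  obtain ⟨z, -, ⟨c, hc, hcz⟩, ⟨d, hd, hdz⟩⟩ := isPreconnected_closed_iff.mp hpre Pm Pk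
    hPmc.isClosed hPkc.isClosed
    (by
      rintro z ⟨hz1 | hz1, hz2⟩
      · exact Or.inr (hz2.resolve_left (hdisj z hz1))
      · exact Or.inl hz1)
    ⟨_, ⟨Or.inr hxP', Or.inl (Set.mem_image_of_mem _ hxH)⟩, hxP'⟩
    ⟨_, ⟨Or.inl hyH, Or.inr hyP⟩, hyP⟩
  simp only at hcz hdz
  have hmk : m - k = d - c := by
    rw [sub_eq_sub_iff_add_eq_add, add_comm m c, hcz, hdz]
  have : F^[n] x - F^[n] y = a - b + (d - c) := by rw [← ham, ← hbk, ← hmk]; abel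
  rw [this] at hwide
  have h1 := norm_add_le (a - b) (d - c)
  linarith [norm_sub_le a b, norm_sub_le d c, hR₀ a (hGP ha), hR₀ b (hGP hb), hR₀ c hc, hR₀ d hd]

theorem nonempty (h : IsGeneratedInvariant Λ F S G) : S.Nonempty :=
  h.isConnected.nonempty.mono h.subset

/-- The displacements of the iterates differ by a bounded amount on `S`. -/
theorem bounded_displacement (h : IsGeneratedInvariant Λ F S G) :
    ∃ C : ℝ, ∀ n : ℕ, ∀ z ∈ S, ∀ w ∈ S, ‖(F^[n] z - z) - (F^[n] w - w)‖ ≤ C := by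
  obtain ⟨C, hC⟩ : ∃ C : ℝ, ∀ n : ℕ, ∀ x ∈ G, ∀ y ∈ G, ‖F^[n] x - F^[n] y‖ ≤ C := by
    by_cases hv : ∃ v ∈ Λ, v ≠ 0 ∧ ∃ x ∈ G, x + v ∈ G
    · obtain ⟨v, hvΛ, hv0, hv⟩ := hv
      exact h.bounded_of_meets hvΛ hv0 hv
    · push Not at hv
      exact h.bounded_of_disjoint hv
  obtain ⟨R, hR⟩ := h.isCompact.isBounded.exists_norm_le
  refine ⟨C + 2 * R, fun n z hz w hw => ?_⟩
  obtain ⟨x, hx, m, hm, rfl⟩ := (h.mem_iff z).mp hz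
  obtain ⟨y, hy, k, hk, rfl⟩ := (h.mem_iff w).mp hw
  rw [iterate_add_of_comm (h.map_add m hm), iterate_add_of_comm (h.map_add k hk),
    add_sub_add_right_eq_sub, add_sub_add_right_eq_sub,
    show F^[n] x - x - (F^[n] y - y) = (F^[n] x - F^[n] y) - (x - y) by abel]
  linarith [norm_sub_le (F^[n] x - F^[n] y) (x - y), hC n x hx y hy, norm_sub_le x y, hR x hx,
    hR y hy]

end IsGeneratedInvariant

/-! ### Quasi-additive sequences and mean displacements -/

/-- A sequence that is additive up to a bounded error stays at bounded distance from a linear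
one. -/
theorem exists_norm_inv_smul_sub_le_of_quasiadditive {E : Type*} [NormedAddCommGroup E]
    [NormedSpace ℝ E] [CompleteSpace E] {a : ℕ → E} {C : ℝ}
    (ha : ∀ m n, ‖a (m + n) - a m - a n‖ ≤ C) :
    ∃ ρ : E, ∀ n : ℕ, n ≠ 0 → ‖(n : ℝ)⁻¹ • a n - ρ‖ ≤ C / n := by
  have hmul : ∀ m n : ℕ, ‖a ((n + 1) * m) - ((n + 1 : ℕ) : ℝ) • a m‖ ≤ n * C := by
    intro m n
    induction n with
    | zero => simp
    | succ n ih =>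
      have h1 : a ((n + 1 + 1) * m) - ((n + 1 + 1 : ℕ) : ℝ) • a m =
          (a ((n + 1) * m + m) - a ((n + 1) * m) - a m) +
            (a ((n + 1) * m) - ((n + 1 : ℕ) : ℝ) • a m) := by
        rw [show (n + 1 + 1) * m = (n + 1) * m + m by ring]
        push_cast
        module
      rw [h1]
      push_cast at ih ⊢
      linarith [norm_add_le (a ((n + 1) * m + m) - a ((n + 1) * m) - a m)
            (a ((n + 1) * m) - ((n : ℝ) + 1) • a m), ha ((n + 1) * m) m]
  have hC : 0 ≤ C := (norm_nonneg _).trans (ha 0 0)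
  have hdiv : ∀ m n : ℕ, m ≠ 0 → n ≠ 0 →
      ‖((n * m : ℕ) : ℝ)⁻¹ • a (n * m) - (m : ℝ)⁻¹ • a m‖ ≤ C / m := by
    intro m n hm hn
    obtain ⟨k, rfl⟩ := Nat.exists_eq_succ_of_ne_zero hn
    have hm0 : (0 : ℝ) < m := by positivity
    have hk0 : (0 : ℝ) < (k + 1 : ℕ) := by positivity
    have h1 : (((k + 1) * m : ℕ) : ℝ)⁻¹ • a ((k + 1) * m) - (m : ℝ)⁻¹ • a m =
        (((k + 1) * m : ℕ) : ℝ)⁻¹ • (a ((k + 1) * m) - ((k + 1 : ℕ) : ℝ) • a m) := by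
      rw [smul_sub, smul_smul]
      congr 2
      rw [Nat.cast_mul]
      field_simp
    rw [Nat.succ_eq_add_one, h1, norm_smul, norm_inv, Real.norm_natCast, inv_mul_le_iff₀
      (by positivity)]
    refine (hmul m k).trans ?_
    rw [Nat.cast_mul, mul_assoc, mul_div_cancel₀ _ hm0.ne']
    exact mul_le_mul_of_nonneg_right (by exact_mod_cast Nat.le_succ k) hC
  have hpair : ∀ m n : ℕ, m ≠ 0 → n ≠ 0 →
      ‖(n : ℝ)⁻¹ • a n - (m : ℝ)⁻¹ • a m‖ ≤ C / m + C / n := by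
    intro m n hm hn
    have h1 := hdiv m n hm hn
    have h2 := hdiv n m hn hm
    rw [mul_comm m n] at h2
    have h3 := norm_sub_le (((n * m : ℕ) : ℝ)⁻¹ • a (n * m) - (m : ℝ)⁻¹ • a m)
      (((n * m : ℕ) : ℝ)⁻¹ • a (n * m) - (n : ℝ)⁻¹ • a n)
    rw [sub_sub_sub_cancel_left] at h3
    linarith
  have hlim : Tendsto (fun n : ℕ => C / n) atTop (𝓝 0) := tendsto_const_div_atTop_nhds_zero_nat C
  have hcau : CauchySeq fun n : ℕ => ((n + 1 : ℕ) : ℝ)⁻¹ • a (n + 1) := by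
    refine cauchySeq_of_le_tendsto_0 (fun N : ℕ => C / (N + 1 : ℕ) + C / (N + 1 : ℕ))
      (fun n m N hn hm => ?_) ?_
    · rw [dist_eq_norm]
      refine (hpair _ _ (Nat.succ_ne_zero m) (Nat.succ_ne_zero n)).trans ?_
      have : ∀ j, N ≤ j → C / (j + 1 : ℕ) ≤ C / (N + 1 : ℕ) := fun j hj =>
        div_le_div_of_nonneg_left hC (by positivity) (by exact_mod_cast Nat.succ_le_succ hj)
      exact add_le_add (this m hm) (this n hn)
    · have := (tendsto_add_atTop_iff_nat 1).mpr hlim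
      simpa using this.add this
  obtain ⟨ρ, hρ⟩ := cauchySeq_tendsto_of_complete hcau
  refine ⟨ρ, fun n hn => ?_⟩
  have h1 : Tendsto (fun k : ℕ => ‖(n : ℝ)⁻¹ • a n - ((k + 1 : ℕ) : ℝ)⁻¹ • a (k + 1)‖) atTop
      (𝓝 ‖(n : ℝ)⁻¹ • a n - ρ‖) := (tendsto_const_nhds.sub hρ).norm
  have h2 : Tendsto (fun k : ℕ => C / (k + 1 : ℕ) + C / n) atTop (𝓝 (0 + C / n)) :=
    ((tendsto_add_atTop_iff_nat 1).mpr hlim).add tendsto_const_nhds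
  rw [zero_add] at h2
  exact le_of_tendsto_of_tendsto' h1 h2 fun k => hpair _ _ (Nat.succ_ne_zero k) hn

/-- Bounded differences of the displacements on an invariant set give a uniform rotation vector. -/
theorem exists_tendstoUniformlyOn_meanDisplacement {F : ℝ × ℝ → ℝ × ℝ} {S : Set (ℝ × ℝ)}
    (hS : S.Nonempty) (hF : Set.MapsTo F S S) {C : ℝ}
    (hC : ∀ n : ℕ, ∀ z ∈ S, ∀ w ∈ S, ‖(F^[n] z - z) - (F^[n] w - w)‖ ≤ C) :
    ∃ ρ : ℝ × ℝ, TendstoUniformlyOn (meanDisplacement F) (fun _ => ρ) atTop S := by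
  obtain ⟨z₀, hz₀⟩ := hS
  obtain ⟨ρ, hρ⟩ := exists_norm_inv_smul_sub_le_of_quasiadditive
    (a := fun n => F^[n] z₀ - z₀) (C := C) fun m n => by
      have := hC m (F^[n] z₀) (hF.iterate n hz₀) z₀ hz₀
      refine (congrArg norm ?_).trans_le this
      simp only [Function.iterate_add_apply]
      abel
  refine ⟨ρ, Metric.tendstoUniformlyOn_iff.mpr fun ε hε => ?_⟩
  have hlim : Tendsto (fun n : ℕ => 2 * C / n) atTop (𝓝 0) :=
    tendsto_const_div_atTop_nhds_zero_nat (2 * C)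
  filter_upwards [hlim.eventually (gt_mem_nhds hε), eventually_ne_atTop 0] with n hn hn0 z hz
  have hnpos : (0 : ℝ) < n := by positivity
  rw [dist_comm, dist_eq_norm]
  have h1 : meanDisplacement F n z - ρ =
      (n : ℝ)⁻¹ • ((F^[n] z - z) - (F^[n] z₀ - z₀)) + ((n : ℝ)⁻¹ • (F^[n] z₀ - z₀) - ρ) := by
    rw [meanDisplacement]
    module
  have h2 : ‖(n : ℝ)⁻¹ • ((F^[n] z - z) - (F^[n] z₀ - z₀))‖ ≤ C / n := by
    rw [norm_smul, norm_inv, Real.norm_natCast, inv_mul_le_iff₀ hnpos,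
      mul_div_cancel₀ _ hnpos.ne']
    exact hC n z hz z₀ hz₀
  rw [h1]
  have h3 := norm_add_le ((n : ℝ)⁻¹ • ((F^[n] z - z) - (F^[n] z₀ - z₀)))
    ((n : ℝ)⁻¹ • (F^[n] z₀ - z₀) - ρ)
  have h4 := hρ n hn0
  have h5 : 2 * C / n = C / n + C / n := by ring
  linarith

/-! ### Plane covers and lifts of maps homotopic to the identity -/

/-- A continuous map from a simply connected space to the circle has a real-valued lift. -/
theorem exists_real_lift {Y : Type} [TopologicalSpace Y] [SimplyConnectedSpace Y]
    [LocallyPathConnectedSpace Y] {φ : Y → UnitAddCircle} (hφ : Continuous φ) :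
    ∃ ψ : Y → ℝ, Continuous ψ ∧ ∀ y, (ψ y : UnitAddCircle) = φ y := by
  obtain ⟨y₀⟩ : Nonempty Y := inferInstance
  obtain ⟨e₀, he₀⟩ := QuotientAddGroup.mk_surjective (φ y₀)
  obtain ⟨ψ, ⟨-, hψ⟩, -⟩ := (AddCircle.isCoveringMap_coe (1 : ℝ)).existsUnique_continuousMap_lifts
    ⟨φ, hφ⟩ y₀ e₀ he₀
  exact ⟨ψ, ψ.continuous, fun y => congrFun hψ y⟩

/-- The properties of the projections `ℝ² → 𝕋²` and `ℝ² → 𝔸` that are used: `proj` is the quotient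
map of the plane by the discrete group `Λ`, and maps from simply connected spaces lift. -/
structure IsPlaneCover {X : Type} [TopologicalSpace X] (proj : ℝ × ℝ → X)
    (Λ : AddSubgroup (ℝ × ℝ)) : Prop where
  continuous : Continuous proj
  isOpenMap : IsOpenMap proj
  finite_le : ∀ R : ℝ, {m : ℝ × ℝ | m ∈ Λ ∧ ‖m‖ ≤ R}.Finite
  eq_iff : ∀ z w, proj z = proj w ↔ w - z ∈ Λ
  exists_lift : ∀ {Y : Type} [TopologicalSpace Y] [SimplyConnectedSpace Y]
    [LocallyPathConnectedSpace Y] (φ : Y → X), Continuous φ →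
    ∃ ψ : Y → ℝ × ℝ, Continuous ψ ∧ ∀ y, proj (ψ y) = φ y

namespace IsPlaneCover

variable {X : Type} [TopologicalSpace X] {proj : ℝ × ℝ → X} {Λ : AddSubgroup (ℝ × ℝ)}

theorem proj_add (c : IsPlaneCover proj Λ) {m : ℝ × ℝ} (hm : m ∈ Λ) (z : ℝ × ℝ) :
    proj (z + m) = proj z :=
  ((c.eq_iff _ _).mpr (by simpa using hm)).symm

theorem countable (c : IsPlaneCover proj Λ) : (Λ : Set (ℝ × ℝ)).Countable := by
  refine (Set.countable_iUnion fun n : ℕ => (c.finite_le n).countable).mono fun m hm => ?_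
  obtain ⟨n, hn⟩ := exists_nat_ge ‖m‖
  exact Set.mem_iUnion.mpr ⟨n, hm, hn⟩

/-- Two lifts of the same map on a connected space differ by a constant. -/
theorem sub_eq_sub (c : IsPlaneCover proj Λ) {Y : Type} [TopologicalSpace Y] [PreconnectedSpace Y]
    {u v : Y → ℝ × ℝ} (hu : Continuous u) (hv : Continuous v) (huv : ∀ y, proj (u y) = proj (v y))
    (x y : Y) : v x - u x = v y - u y :=
  isPreconnected_univ.eq_of_mapsTo_countable (f := fun y => v y - u y)
    (hv.sub hu).continuousOn c.countable (fun y _ => (c.eq_iff _ _).mp (huv y)) trivial trivial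

/-- A lift of a map homotopic to the identity commutes with the deck transformations: lift the
homotopy. -/
theorem map_add_of_isHomotopicToId (c : IsPlaneCover proj Λ) {f : X ≃ₜ X} (hf : IsHomotopicToId f)
    {F : ℝ × ℝ → ℝ × ℝ} (hF : IsPlaneLift proj f F) {m : ℝ × ℝ} (hm : m ∈ Λ) (z : ℝ × ℝ) :
    F (z + m) = F z + m := by
  obtain ⟨H⟩ := hf
  have hproj := c.continuous
  obtain ⟨Φ, hΦ, hΦH⟩ := c.exists_lift
    (fun y : ℝ × (ℝ × ℝ) => H (Set.projIcc 0 1 zero_le_one y.1, proj y.2))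
    (H.continuous.comp ((continuous_projIcc.comp continuous_fst).prodMk
      (hproj.comp continuous_snd)))
  have h1 := c.sub_eq_sub (u := Φ) (v := fun y : ℝ × (ℝ × ℝ) => Φ (y.1, y.2 + m)) hΦ
    (by fun_prop) (fun y => by rw [hΦH, hΦH]; simp only [c.proj_add hm]) (1, z) (0, z)
  have h2 := c.sub_eq_sub (u := fun w => w) (v := fun w => Φ (1, w)) continuous_id
    (by fun_prop) (fun w => by rw [hΦH]; simp) (z + m) z
  have h3 := c.sub_eq_sub (u := F) (v := fun w => Φ (0, w)) hF.1
    (by fun_prop) (fun w => by rw [hΦH, hF.2]; simp) (z + m) z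
  simp only at h1 h2 h3
  linear_combination (exp := 1) h2 - h1 - h3

theorem injective_of_lift (c : IsPlaneCover proj Λ) {f : X ≃ₜ X} {F : ℝ × ℝ → ℝ × ℝ}
    (hF : IsPlaneLift proj f F) (hadd : ∀ m ∈ Λ, ∀ z, F (z + m) = F z + m) :
    Function.Injective F := by
  intro z w hzw
  have h1 : proj z = proj w := f.injective (by rw [← hF.2, ← hF.2, hzw])
  have h2 := hadd _ ((c.eq_iff _ _).mp h1) z
  rw [add_sub_cancel, hzw, left_eq_add] at h2
  exact (sub_eq_zero.mp h2).symm

/-- A component of the preimage of an open set projects onto a union of components: the projections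
of two components are open and either equal or disjoint. -/
theorem subset_image_connectedComponentIn (c : IsPlaneCover proj Λ) {U V : Set X} (hU : IsOpen U)
    (hV : IsPreconnected V) (hVU : V ⊆ U) {p : ℝ × ℝ} (hp : proj p ∈ V)
    (hsurj : Function.Surjective proj) :
    V ⊆ proj '' connectedComponentIn (proj ⁻¹' U) p := by
  have hUo : IsOpen (proj ⁻¹' U) := hU.preimage c.continuous
  set D := connectedComponentIn (proj ⁻¹' U) p with hD
  have hpD : p ∈ D := mem_connectedComponentIn (hVU hp)
  set W : Set X := ⋃ q ∈ {q : ℝ × ℝ | proj q ∈ U ∧ proj q ∉ proj '' D},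
    proj '' connectedComponentIn (proj ⁻¹' U) q with hW
  refine hV.subset_left_of_subset_union (c.isOpenMap _ hUo.connectedComponentIn) (v := W)
    (isOpen_biUnion fun q _ => c.isOpenMap _ hUo.connectedComponentIn) ?_ ?_
    ⟨_, hp, Set.mem_image_of_mem _ hpD⟩
  · rw [Set.disjoint_left]
    rintro _ ⟨d, hd, rfl⟩ hdW
    simp only [hW, Set.mem_iUnion] at hdW
    obtain ⟨q, ⟨hqU, hqD⟩, e, he, hed⟩ := hdW
    have hm := (c.eq_iff _ _).mp hed
    have hsub : (fun z => z + (d - e)) '' connectedComponentIn (proj ⁻¹' U) q ⊆ D := by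
      rw [hD, connectedComponentIn_eq hd]
      refine IsPreconnected.subset_connectedComponentIn
        (isPreconnected_connectedComponentIn.image _ (by fun_prop))
        ⟨e, he, add_sub_cancel _ _⟩ ?_
      rintro _ ⟨z, hz, rfl⟩
      show proj (z + (d - e)) ∈ U
      rw [c.proj_add hm]
      exact (connectedComponentIn_subset (proj ⁻¹' U) q hz : z ∈ proj ⁻¹' U)
    refine hqD ⟨q + (d - e), hsub (Set.mem_image_of_mem _ ?_), c.proj_add hm q⟩
    exact mem_connectedComponentIn hqU
  · intro x hx
    by_cases hxD : x ∈ proj '' D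
    · exact Or.inl hxD
    · obtain ⟨q, rfl⟩ := hsurj x
      exact Or.inr (Set.mem_biUnion (x := q) ⟨hVU hx, hxD⟩
        (Set.mem_image_of_mem _ (mem_connectedComponentIn (hVU hx))))

theorem interior_preimage (c : IsPlaneCover proj Λ) {A : Set X} (hA : IsThin A) :
    interior (proj ⁻¹' A) = ∅ := by
  have h : proj '' interior (proj ⁻¹' A) ⊆ interior A :=
    interior_maximal ((Set.image_mono interior_subset).trans (Set.image_preimage_subset _ _))
      (c.isOpenMap _ isOpen_interior)
  rw [hA] at h
  exact Set.image_eq_empty.mp (Set.subset_empty_iff.mp h)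

/-- Rotation vectors are unique on an invariant thin set whose preimage is generated by a continuum
and has only unbounded complementary components. -/
theorem exists_rotation_vector (c : IsPlaneCover proj Λ) {f : X ≃ₜ X} {F : ℝ × ℝ → ℝ × ℝ}
    {A : Set X} (hf : IsHomotopicToId f) (hF : IsPlaneLift proj f F) (hA : IsThin A)
    (hfA : f '' A = A) {G : Set (ℝ × ℝ)} (hGc : IsCompact G) (hG : IsConnected G)
    (hGA : ∀ z, proj z ∈ A ↔ ∃ x ∈ G, ∃ m ∈ Λ, x + m = z)
    (hunb : ∀ p, proj p ∉ A →
      ∃ D : Set (ℝ × ℝ), IsPreconnected D ∧ p ∈ D ∧ D ⊆ (proj ⁻¹' A)ᶜ ∧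
        ¬ Bornology.IsBounded D) :
    ∃ ρ : ℝ × ℝ, TendstoUniformlyOn (meanDisplacement F) (fun _ => ρ) atTop (proj ⁻¹' A) := by
  have hadd : ∀ m ∈ Λ, ∀ z, F (z + m) = F z + m := fun m hm z =>
    c.map_add_of_isHomotopicToId hf hF hm z
  have h : IsGeneratedInvariant Λ F (proj ⁻¹' A) G :=
    { finite_le := c.finite_le
      continuous := hF.1
      injective := c.injective_of_lift hF hadd
      map_add := hadd
      mapsTo := fun z hz => by
        show proj (F z) ∈ A
        rw [hF.2, ← hfA]
        exact Set.mem_image_of_mem f hz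
      isCompact := hGc
      isConnected := hG
      mem_iff := hGA
      thin := c.interior_preimage hA
      unbounded := hunb }
  obtain ⟨C, hC⟩ := h.bounded_displacement
  exact exists_tendstoUniformlyOn_meanDisplacement h.nonempty h.mapsTo hC

end IsPlaneCover

/-! ### The annulus and the torus -/

theorem finite_zmultiples_one_le (R : ℝ) :
    {r : ℝ | r ∈ AddSubgroup.zmultiples (1 : ℝ) ∧ ‖r‖ ≤ R}.Finite := by
  refine ((Set.finite_Icc (-⌈R⌉) ⌈R⌉).image fun n : ℤ => (n : ℝ)).subset ?_
  rintro r ⟨hr, hrR⟩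
  obtain ⟨n, rfl⟩ := AddSubgroup.mem_zmultiples_iff.mp hr
  rw [zsmul_one, Real.norm_eq_abs] at hrR
  refine ⟨n, ?_, by simp⟩
  have := abs_le.mp (hrR.trans (Int.le_ceil R))
  exact ⟨by exact_mod_cast this.1, by exact_mod_cast this.2⟩

theorem isPlaneCover_torusProj : IsPlaneCover torusProj
    ((AddSubgroup.zmultiples (1 : ℝ)).prod (AddSubgroup.zmultiples (1 : ℝ))) where
  continuous := (AddCircle.continuous_mk' 1).prodMap (AddCircle.continuous_mk' 1)
  isOpenMap := QuotientAddGroup.isOpenMap_coe.prodMap QuotientAddGroup.isOpenMap_coe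
  finite_le R := by
    refine ((finite_zmultiples_one_le R).prod (finite_zmultiples_one_le R)).subset ?_
    rintro ⟨a, b⟩ ⟨⟨ha, hb⟩, hR⟩
    exact ⟨⟨ha, (norm_fst_le (a, b)).trans hR⟩, ⟨hb, (norm_snd_le (a, b)).trans hR⟩⟩
  eq_iff z w := by
    rw [AddSubgroup.mem_prod, torusProj, torusProj, Prod.mk.injEq, QuotientAddGroup.eq,
      QuotientAddGroup.eq, Prod.fst_sub, Prod.snd_sub, neg_add_eq_sub, neg_add_eq_sub]
  exists_lift φ hφ := by
    obtain ⟨a, ha, hae⟩ := exists_real_lift (continuous_fst.comp hφ)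
    obtain ⟨b, hb, hbe⟩ := exists_real_lift (continuous_snd.comp hφ)
    exact ⟨fun y => (a y, b y), ha.prodMk hb, fun y => Prod.ext (hae y) (hbe y)⟩

theorem isPlaneCover_annulusProj : IsPlaneCover annulusProj
    ((AddSubgroup.zmultiples (1 : ℝ)).prod ⊥) where
  continuous := (AddCircle.continuous_mk' 1).prodMap continuous_id
  isOpenMap := QuotientAddGroup.isOpenMap_coe.prodMap IsOpenMap.id
  finite_le R := by
    refine ((finite_zmultiples_one_le R).prod (Set.finite_singleton (0 : ℝ))).subset ?_
    rintro ⟨a, b⟩ ⟨⟨ha, hb⟩, hR⟩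
    exact ⟨⟨ha, (norm_fst_le (a, b)).trans hR⟩, hb⟩
  eq_iff z w := by
    rw [AddSubgroup.mem_prod, annulusProj, annulusProj, Prod.mk.injEq, QuotientAddGroup.eq,
      Prod.fst_sub, Prod.snd_sub, neg_add_eq_sub, AddSubgroup.mem_bot, sub_eq_zero, eq_comm (a := z.2)]
  exists_lift φ hφ := by
    obtain ⟨a, ha, hae⟩ := exists_real_lift (continuous_fst.comp hφ)
    exact ⟨fun y => (a y, (φ y).2), ha.prodMk (continuous_snd.comp hφ),
      fun y => Prod.ext (hae y) rfl⟩

theorem surjective_torusProj : Function.Surjective torusProj :=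
  QuotientAddGroup.mk_surjective.prodMap QuotientAddGroup.mk_surjective

theorem surjective_annulusProj : Function.Surjective annulusProj :=
  QuotientAddGroup.mk_surjective.prodMap Function.surjective_id

theorem intCast_mem_zmultiples_one (n : ℤ) : (n : ℝ) ∈ AddSubgroup.zmultiples (1 : ℝ) :=
  AddSubgroup.mem_zmultiples_iff.mpr ⟨n, by simp⟩

/-- In the universal cover of the annulus the complement of an essential annular continuum has only
unbounded components. -/
theorem unbounded_compl_annulus {A : Set OpenAnnulus} (hA : IsEssentialAnnularContinuumAnnulus A)
    {p : ℝ × ℝ} (hp : annulusProj p ∉ A) :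
    ∃ D : Set (ℝ × ℝ), IsPreconnected D ∧ p ∈ D ∧ D ⊆ (annulusProj ⁻¹' A)ᶜ ∧
      ¬ Bornology.IsBounded D := by
  obtain ⟨hAc, -, x, -, y, -, -, hx, hy, hxy⟩ := hA
  obtain ⟨V, hV, hVA, hpV, hVb⟩ : ∃ V : Set OpenAnnulus, IsPreconnected V ∧ V ⊆ Aᶜ ∧
      annulusProj p ∈ V ∧ ¬ Bornology.IsBounded V := by
    have hp' : annulusProj p ∈ Aᶜ := hp
    rw [hxy] at hp'
    rcases hp' with h | h
    · exact ⟨_, isPreconnected_connectedComponentIn, connectedComponentIn_subset _ _, h, hx⟩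
    · exact ⟨_, isPreconnected_connectedComponentIn, connectedComponentIn_subset _ _, h, hy⟩
  refine ⟨connectedComponentIn (annulusProj ⁻¹' Aᶜ) p, isPreconnected_connectedComponentIn,
    mem_connectedComponentIn hp, connectedComponentIn_subset _ _, fun hb => hVb ?_⟩
  refine ((hb.isCompact_closure.image isPlaneCover_annulusProj.continuous).isBounded).subset ?_
  exact (isPlaneCover_annulusProj.subset_image_connectedComponentIn hAc.isClosed.isOpen_compl hV
    hVA hpV surjective_annulusProj).trans (Set.image_mono subset_closure)

theorem exists_rotation_vector_annulus {f : OpenAnnulus ≃ₜ OpenAnnulus} {F : ℝ × ℝ → ℝ × ℝ}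
    {A : Set OpenAnnulus} (hf : IsHomotopicToId f) (hF : IsPlaneLift annulusProj f F)
    (hA : IsEssentialAnnularContinuumAnnulus A) (hthin : IsThin A)
    (hgen : IsCompactlyGeneratedAnnulus A) (hfA : f '' A = A) :
    ∃ ρ : ℝ, TendstoUniformlyOn (meanDisplacement F) (fun _ => ((ρ, 0) : ℝ × ℝ)) atTop
      (annulusProj ⁻¹' A) := by
  obtain ⟨G, hGc, hG, hGA⟩ := hgen
  have hmem : ∀ z, annulusProj z ∈ A ↔
      ∃ x ∈ G, ∃ m ∈ (AddSubgroup.zmultiples (1 : ℝ)).prod ⊥, x + m = z := by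
    intro z
    rw [← Set.mem_preimage, ← hGA, Set.mem_iUnion]
    constructor
    · rintro ⟨n, x, hx, rfl⟩
      exact ⟨x, hx, ((n : ℝ), 0), ⟨intCast_mem_zmultiples_one n, rfl⟩,
        Prod.ext rfl (add_zero x.2)⟩
    · rintro ⟨x, hx, ⟨a, b⟩, ⟨ha, hb⟩, rfl⟩
      obtain ⟨n, rfl⟩ := AddSubgroup.mem_zmultiples_iff.mp ha
      obtain rfl : b = 0 := hb
      exact ⟨n, x, hx, Prod.ext (by simp [horizontalShift]) (by simp [horizontalShift])⟩
  obtain ⟨ρ, hρ⟩ := isPlaneCover_annulusProj.exists_rotation_vector hf hF hthin hfA hGc hG hmem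
    fun p hp => unbounded_compl_annulus hA hp
  obtain ⟨z, hzG⟩ := hG.nonempty
  have hz : z ∈ annulusProj ⁻¹' A := (hmem z).mpr ⟨z, hzG, 0, zero_mem _, add_zero z⟩
  -- the heights of the points over the compact set `A` are bounded
  obtain ⟨R, hR⟩ := (hA.1.image continuous_snd).isBounded.exists_norm_le
  have hmaps : Set.MapsTo F (annulusProj ⁻¹' A) (annulusProj ⁻¹' A) := fun w hw => by
    show annulusProj (F w) ∈ A
    rw [hF.2, ← hfA]
    exact Set.mem_image_of_mem f hw
  have hR' : ∀ w ∈ annulusProj ⁻¹' A, ‖w.2‖ ≤ R := fun w hw => hR _ ⟨_, hw, rfl⟩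
  have h1 : Tendsto (fun n : ℕ => (meanDisplacement F n z).2) atTop (𝓝 ρ.2) :=
    (continuous_snd.tendsto ρ).comp (hρ.tendsto_at hz)
  have h2 : Tendsto (fun n : ℕ => (meanDisplacement F n z).2) atTop (𝓝 0) := by
    refine squeeze_zero_norm (fun n => ?_) (tendsto_const_div_atTop_nhds_zero_nat (R + R))
    have : ‖(F^[n] z).2 - z.2‖ ≤ R + R :=
      (norm_sub_le _ _).trans (add_le_add (hR' _ (hmaps.iterate n hz)) (hR' z hz))
    rw [meanDisplacement, Prod.smul_snd, Prod.snd_sub, norm_smul, norm_inv, Real.norm_natCast,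
      inv_mul_eq_div]
    exact div_le_div_of_nonneg_right this (Nat.cast_nonneg n)
  have h3 : ρ.2 = 0 := tendsto_nhds_unique h1 h2
  refine ⟨ρ.1, ?_⟩
  rw [← h3]
  exact hρ

/-- A homeomorphism of the torus has an injective lift to the plane: composing with a lift of the
inverse gives a lift of the identity, which is a translation. -/
theorem exists_injective_lift_torus (h : Torus2 ≃ₜ Torus2) :
    ∃ k : ℝ × ℝ → ℝ × ℝ, Continuous k ∧ Function.Injective k ∧
      ∀ z, torusProj (k z) = h (torusProj z) := by
  have c := isPlaneCover_torusProj
  obtain ⟨k, hk, hkh⟩ := c.exists_lift (fun z : ℝ × ℝ => h (torusProj z))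
    (h.continuous.comp c.continuous)
  obtain ⟨l, hl, hlh⟩ := c.exists_lift (fun z : ℝ × ℝ => h.symm (torusProj z))
    (h.symm.continuous.comp c.continuous)
  refine ⟨k, hk, fun z w hzw => ?_, hkh⟩
  have := c.sub_eq_sub (u := fun z => z) (v := fun z => l (k z)) continuous_id (hl.comp hk)
    (fun y => by rw [hlh, hkh, h.symm_apply_apply]) z w
  simp only [hzw] at this
  exact sub_right_injective this

/-- In the universal cover of the torus the complement of an essential annular continuum has only
unbounded components, provided that some homeomorphism makes it horizontal: each component contains
a lift of the image of the horizontal curve, which is unbounded. -/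
theorem unbounded_compl_torus {A : Set Torus2} (hA : IsEssentialAnnularContinuumTorus A)
    {h : Torus2 ≃ₜ Torus2} (hhor : IsHorizontalTorus (h '' A)) {p : ℝ × ℝ}
    (hp : torusProj p ∉ A) :
    ∃ D : Set (ℝ × ℝ), IsPreconnected D ∧ p ∈ D ∧ D ⊆ (torusProj ⁻¹' A)ᶜ ∧
      ¬ Bornology.IsBounded D := by
  have c := isPlaneCover_torusProj
  obtain ⟨hAc, -, ⟨e⟩⟩ := hA
  obtain ⟨γ, hγ, hγ1, -, hγA⟩ := hhor
  obtain ⟨k, hk, hkinj, hkh⟩ := exists_injective_lift_torus h.symm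
  have hkA : ∀ t, torusProj (k (γ t)) ∉ A := by
    intro t ht
    rw [hkh] at ht
    exact hγA t ⟨_, ht, h.apply_symm_apply _⟩
  have hconn : IsPreconnected Aᶜ := by
    have : PreconnectedSpace (Aᶜ : Set Torus2) :=
      e.symm.surjective.denseRange.preconnectedSpace e.symm.continuous
    exact isPreconnected_iff_preconnectedSpace.mpr this
  have hsub := c.subset_image_connectedComponentIn hAc.isClosed.isOpen_compl hconn subset_rfl hp
    surjective_torusProj
  obtain ⟨d, hd, hdk⟩ := hsub (hkA 0)
  have hm := (c.eq_iff _ _).mp hdk.symm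
  set m := d - k (γ 0) with hmdef
  have hΓ : (fun t => k (γ t) + m) '' Set.univ ⊆ connectedComponentIn (torusProj ⁻¹' Aᶜ) p := by
    rw [connectedComponentIn_eq hd]
    refine IsPreconnected.subset_connectedComponentIn
      (isPreconnected_univ.image _ (by fun_prop)) ⟨0, trivial, by simp [hmdef]⟩ ?_
    rintro _ ⟨t, -, rfl⟩
    show torusProj (k (γ t) + m) ∉ A
    rw [c.proj_add hm]
    exact hkA t
  refine ⟨connectedComponentIn (torusProj ⁻¹' Aᶜ) p, isPreconnected_connectedComponentIn,
    mem_connectedComponentIn hp, connectedComponentIn_subset _ _, fun hb => ?_⟩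
  -- `k (z + (1, 0)) - k z` is a constant vector `w`, nonzero since `k` is injective, so that
  -- `k ∘ γ` is unbounded
  have h10 : ((1, 0) : ℝ × ℝ) ∈
      (AddSubgroup.zmultiples (1 : ℝ)).prod (AddSubgroup.zmultiples (1 : ℝ)) :=
    ⟨AddSubgroup.mem_zmultiples 1, zero_mem _⟩
  set w := k (γ 0 + (1, 0)) - k (γ 0) with hw
  have hw0 : w ≠ 0 := by
    intro h0
    have := hkinj (sub_eq_zero.mp h0)
    simp at this
  have hstep : ∀ z, k (z + (1, 0)) = k z + w := by
    intro z
    have := c.sub_eq_sub (u := k) (v := fun z => k (z + (1, 0))) hk (by fun_prop)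
      (fun z => by rw [hkh, hkh, c.proj_add h10]) z (γ 0)
    rw [hw, ← this]
    simp
  have hiter : ∀ n : ℕ, k (γ n) = k (γ 0) + n • w := by
    intro n
    induction n with
    | zero => simp
    | succ n ih => rw [Nat.cast_succ, hγ1, hstep, ih, succ_nsmul, add_assoc]
  obtain ⟨R, hR⟩ := hb.exists_norm_le
  obtain ⟨n, hn⟩ := exists_nat_gt ((R + ‖k (γ 0) + m‖) / ‖w‖)
  rw [div_lt_iff₀ (norm_pos_iff.mpr hw0)] at hn
  have h1 := hR _ (hΓ ⟨n, trivial, rfl⟩)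
  simp only [hiter] at h1
  have h2 := norm_sub_le (k (γ 0) + n • w + m) (k (γ 0) + m)
  rw [show k (γ 0) + n • w + m - (k (γ 0) + m) = n • w by abel, ← Nat.cast_smul_eq_nsmul ℝ,
    norm_smul, Real.norm_natCast] at h2
  rw [← Nat.cast_smul_eq_nsmul ℝ] at h1
  linarith

theorem exists_rotation_vector_torus {f : Torus2 ≃ₜ Torus2} {F : ℝ × ℝ → ℝ × ℝ}
    {A : Set Torus2} (hf : IsHomotopicToId f) (hF : IsPlaneLift torusProj f F)
    (hA : IsEssentialAnnularContinuumTorus A) (hthin : IsThin A)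
    (hgen : IsCompactlyGeneratedTorus A) (hfA : f '' A = A) :
    ∃ ρ : ℝ × ℝ, TendstoUniformlyOn (meanDisplacement F) (fun _ => ρ) atTop
      (torusProj ⁻¹' A) := by
  have c := isPlaneCover_torusProj
  obtain ⟨h, -, hhor, x, -, G, hGc, hG, -, hGA⟩ := hgen
  obtain ⟨k, hk, -, hkh⟩ := exists_injective_lift_torus h.symm
  have hshift : ∀ (n : ℤ) (z : ℝ × ℝ), torusProj (horizontalShift n z) = torusProj z := by
    intro n z
    refine ((c.eq_iff _ _).mpr ?_).symm
    refine ⟨?_, ?_⟩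
    · simp [horizontalShift]
    · simp [horizontalShift]
  refine c.exists_rotation_vector hf hF hthin hfA (hGc.image hk) (hG.image k hk.continuousOn)
    (fun z => ⟨fun hz => ?_, ?_⟩) fun p hp => unbounded_compl_torus hA hhor hp
  · obtain ⟨y, hy, hyz⟩ := hGA.symm.subset (Set.mem_image_of_mem h hz)
    obtain ⟨n, g, hg, rfl⟩ := Set.mem_iUnion.mp hy
    rw [hshift] at hyz
    have h1 : torusProj (k g) = torusProj z := by rw [hkh, hyz, h.symm_apply_apply]
    exact ⟨k g, Set.mem_image_of_mem k hg, z - k g, (c.eq_iff _ _).mp h1, add_sub_cancel _ _⟩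
  · rintro ⟨_, ⟨g, hg, rfl⟩, m, hm, rfl⟩
    rw [c.proj_add hm, hkh]
    obtain ⟨a, ha, hag⟩ := hGA.subset
      ⟨horizontalShift 0 g, Set.mem_iUnion.mpr ⟨0, Set.mem_image_of_mem _ hg⟩, rfl⟩
    rw [hshift] at hag
    rwa [← hag, h.symm_apply_apply]

theorem mainTheorem3 :
    (∀ (f : Torus2 ≃ₜ Torus2) (F : ℝ × ℝ → ℝ × ℝ) (A : Set Torus2),
      IsHomotopicToId f → IsPlaneLift torusProj f F →
      IsEssentialAnnularContinuumTorus A → IsThin A → IsCompactlyGeneratedTorus A →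
      f '' A = A →
      ∃ ρ : ℝ × ℝ,
        (∀ z ∈ torusProj ⁻¹' A, Tendsto (fun n : ℕ => meanDisplacement F n z) atTop (𝓝 ρ)) ∧
        TendstoUniformlyOn (meanDisplacement F) (fun _ => ρ) atTop (torusProj ⁻¹' A)) ∧
    (∀ (f : OpenAnnulus ≃ₜ OpenAnnulus) (F : ℝ × ℝ → ℝ × ℝ) (A : Set OpenAnnulus),
      IsHomotopicToId f → IsPlaneLift annulusProj f F →
      IsEssentialAnnularContinuumAnnulus A → IsThin A → IsCompactlyGeneratedAnnulus A →
      f '' A = A →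
      ∃ ρ : ℝ,
        (∀ z ∈ annulusProj ⁻¹' A,
          Tendsto (fun n : ℕ => meanDisplacement F n z) atTop (𝓝 (ρ, 0))) ∧
        TendstoUniformlyOn (meanDisplacement F) (fun _ => ((ρ, 0) : ℝ × ℝ)) atTop
          (annulusProj ⁻¹' A)) := by
  refine ⟨fun f F A hf hF hA hthin hgen hfA => ?_, fun f F A hf hF hA hthin hgen hfA => ?_⟩
  · obtain ⟨ρ, hρ⟩ := exists_rotation_vector_torus hf hF hA hthin hgen hfA
    exact ⟨ρ, fun z hz => hρ.tendsto_at hz, hρ⟩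
  · obtain ⟨ρ, hρ⟩ := exists_rotation_vector_annulus hf hF hA hthin hgen hfA
    exact ⟨ρ, fun z hz => hρ.tendsto_at hz, hρ⟩
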